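/- **Setting.** Let $X$ be a complete separable metric space with distance $d$, let $\mu$ be a Radon measure on $X$, and suppose that $(X,\mu)$ is a differentiability space: there is a countable atlas of charts $(U_\alpha,\phi_\alpha)$ with $U_\alpha\subset X$ Borel of positive measure, $\phi_\alpha:X\to\mathbb R^{N_\alpha}$ Lipschitz and $\mu(X\setminus\bigcup_\alpha U_\alpha)=0$, such that on $U_\alpha$, $\mu$-almost everywhere, the components of $\phi_\alpha$ are independent to first order and each Lipschitz $f:X\to\mathbb R$ is *differentiable* with respect to $\phi_\alpha$, i.e. $f(x)=f(x_0)+\sum_i\frac{\partial f}{\partial\phi_\alpha^i}(x_0)(\phi^i_\alpha(x)-\phi^i_\alpha(x_0))+o(d(x,x_0))$. As usual, the $U_\alpha$ are chosen so that the components of $\phi_\alpha$ are independent to first order at every point of $U_\alpha$, and $\phi_\beta$ is differentiable with respect to $\phi_\alpha$, with derivative $g_{\alpha\beta}(x)$, at every $x\in U_\alpha\cap U_\beta$. An element of $T_yX$, for $y\in\bigcup_\alpha U_\alpha$, is a family $v=(v_\alpha)_{\alpha:\,y\in U_\alpha}$ of vectors $v_\alpha\in\mathbb R^{N_\alpha}$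 with $g_{\alpha\beta}(y)v_\alpha=v_\beta$, and $df|_y(v)=\sum_i\frac{\partial f}{\partial\phi_\alpha^i}(y)v_\alpha^i$ if $f$ is differentiable at $y$ with respect to the charts around $y$. A *fragment* is a Lipschitz map $\gamma:C\to X$ with $C\subset\mathbb R$ closed. A pseudometric $\varrho$ on $X$ is *Lipschitz compatible* if $\varrho\le c\,d$ for some constant $c$; put $\varrho_x=\varrho(x,\cdot)$. A number $m\ge 0$ is the $\varrho$-*metric differential* $\varrho\text{-md}\,\gamma(t)$ if $\lambda\varrho(\gamma(t+x_1/\lambda),\gamma(t+x_2/\lambda))\to m|x_1-x_2|$ as $\lambda\to\infty$, uniformly on compact sets of pairs $(x_1,x_2)$, as far as the left-hand side is defined. Let $\mathcal H^1_\varrho$ be the $1$-dimensional Hausdorff measure of $\varrho$. The $\varrho$-*length* of $\gamma$ is the Hausdorff measure of its image counted with multiplicity, $$\operatorname{length}_\varrho(\gamma)=\int_{X/\varrho}\#\{t\in C:[\gamma(t)]=z\}\,d\mathcal H^1(z),$$ where $X/\varrho$ is the metric space obtained from $X$ by identifying points at $\varrho$-distance $0$. Let $\mathcal F$ be a countable set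 of Lipschitz functions on $X$, $\mathcal C$ a countable set of bounded Borel functions on $X$, $\mathcal S$ a countable set of Lipschitz compatible pseudometrics with $d\in\mathcal S$, and $D\subset X$ a countable dense set. For a fragment $\gamma:C\to X$ and $t\in C$, the pair $(\gamma,t)$ is *generic* if 1. $t$ is a Lebesgue density point of $C$; 2. for $f\in\mathcal F$, the derivative $(f\circ\gamma)'$ exists and is approximately continuous at $t$; 3. for $u\in\mathcal C$, $u\circ\gamma$ is approximately continuous at $t$; 4. for $x\in D$ and $\varrho\in\mathcal S$, the derivative $(\varrho_x\circ\gamma)'$ exists and is approximately continuous at $t$; 5. for $\varrho\in\mathcal S$, the function $\sup_{x\in D}|(\varrho_x\circ\gamma)'|$ is approximately continuous at $t$. Fix $\varrho\in\mathcal S$ (for example $\varrho=d$) and a Borel set $V\subset\bigcup_\alpha U_\alpha$ with $\mu(\bigcup_\alpha U_\alpha\setminus V)=0$ such that every $\varrho_x$, $x\in D$, is differentiable at every point of $V$ with respect to the charts around it. For $y\in V$ and $v\in T_yX$ put $\|v\|_\varrho=\sup_{x\in D}|d\varrho_x|_y(v)|$. Assume that $\mathcal F$ contains all components of the $\phi_\alpha$,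 and that $\mathcal C$ contains the characteristic functions of $V$ and of all $U_\alpha$. A fragment $\gamma$ is *generic* if, for almost every $t\in C$, the pair $(\gamma,t)$ is generic and $\gamma(t)\in V$. **Theorem.** Let $\gamma:C\to X$ be a fragment. (1) If $(\gamma,t)$ is a generic pair and $\gamma(t)\in V$, then the velocity vector $\gamma'(t)=\big((\phi_\alpha\circ\gamma)'(t)\big)_\alpha\in T_{\gamma(t)}X$ is well defined, $\gamma$ is $\varrho$-metrically differentiable at $t$, and $$\varrho\text{-md}\,\gamma(t)=\|\gamma'(t)\|_\varrho .$$ (2) If $\gamma(C)\subset V$, then $\gamma$ is generic. (3) If $\gamma$ is generic, then $$\operatorname{length}_\varrho(\gamma)=\int_C\|\gamma'(t)\|_\varrho\,dt .$$ If moreover $\varrho(\gamma(s),\gamma(t))>0$ for all $s\ne t$ in $C$, then the left-hand side is the Hausdorff measure of the image: $\mathcal H^1_\varrho(\gamma(C))=\int_C\|\gamma'(t)\|_\varrho\,dt$. -/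

import Mathlib

open MeasureTheory Filter Topology Asymptotics Set
open scoped ENNReal NNReal

noncomputable section

namespace MetricDiff

/-! ### Differentiability spaces -/

/-- The function `v` is constant to first order at `x`: `|v y - v x| = o(d(x, y))`. -/
def ConstToFirstOrderAt {X : Type*} [MetricSpace X] (v : X → ℝ) (x : X) : Prop :=
  (fun y => v y - v x) =o[𝓝 x] fun y => dist y x

/-- The finite tuple `u` is dependent at `x`: some nontrivial linear combination of its entries is
constant to first order at `x`. -/
def DependentAt {X : Type*} [MetricSpace X] {n : ℕ} (u : Fin n → X → ℝ) (x : X) : Prop :=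
  ∃ c : Fin n → ℝ, c ≠ 0 ∧ ConstToFirstOrderAt (fun y => ∑ i, c i * u i y) x

/-- The component functions of a map into `ℝⁿ`. -/
def components {X : Type*} {n : ℕ} (φ : X → EuclideanSpace ℝ (Fin n)) : Fin n → X → ℝ :=
  fun i y => φ y i

/-- `(U, φ)` is a chart of the metric measure space `(X, μ)`, of dimension `n`. -/
structure IsChart {X : Type*} [MetricSpace X] [MeasurableSpace X] (μ : Measure X)
    (U : Set X) {n : ℕ} (φ : X → EuclideanSpace ℝ (Fin n)) : Prop where
  measurableSet : MeasurableSet U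
  pos : 0 < μ U
  lipschitz : ∃ K, LipschitzWith K φ
  independent : ∀ᵐ x ∂μ, x ∈ U → ¬ DependentAt (components φ) x
  dependent : ∀ f : X → ℝ, (∃ K, LipschitzWith K f) →
    ∀ᵐ x ∂μ, x ∈ U → DependentAt (Matrix.vecCons f (components φ)) x

/-- First order Taylor expansion of `f` at `x` with respect to `φ`, with linear part `L`:
`f y = f x + L (φ y - φ x) + o(d(x, y))`. -/
def HasChartDerivAt {X : Type*} [MetricSpace X] {n : ℕ} {F : Type*} [NormedAddCommGroup F]
    [NormedSpace ℝ F] (φ : X → EuclideanSpace ℝ (Fin n)) (f : X → F) (x : X)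
    (L : EuclideanSpace ℝ (Fin n) →L[ℝ] F) : Prop :=
  (fun y => f y - f x - L (φ y - φ x)) =o[𝓝 x] fun y => dist y x

/-- `f` is differentiable at `x` with respect to `φ`. -/
def ChartDifferentiableAt {X : Type*} [MetricSpace X] {n : ℕ} {F : Type*} [NormedAddCommGroup F]
    [NormedSpace ℝ F] (φ : X → EuclideanSpace ℝ (Fin n)) (f : X → F) (x : X) : Prop :=
  ∃ L, HasChartDerivAt φ f x L

open Classical in
/-- The derivative of `f` at `x` with respect to `φ`, that is, the vector (or matrix) of the
partial derivatives `∂f/∂φⁱ (x)`; it is unique where the components of `φ` are independent, see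
`HasChartDerivAt.unique`. It is set to `0` where `f` is not differentiable. -/
def chartDeriv {X : Type*} [MetricSpace X] {n : ℕ} {F : Type*} [NormedAddCommGroup F]
    [NormedSpace ℝ F] (φ : X → EuclideanSpace ℝ (Fin n)) (f : X → F) (x : X) :
    EuclideanSpace ℝ (Fin n) →L[ℝ] F :=
  if h : ChartDifferentiableAt φ f x then h.choose else 0

theorem ChartDifferentiableAt.hasChartDerivAt {X : Type*} [MetricSpace X] {n : ℕ} {F : Type*}
    [NormedAddCommGroup F] [NormedSpace ℝ F] {φ : X → EuclideanSpace ℝ (Fin n)} {f : X → F} {x : X}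
    (h : ChartDifferentiableAt φ f x) : HasChartDerivAt φ f x (chartDeriv φ f x) := by
  rw [chartDeriv, dif_pos h]
  exact h.choose_spec

theorem HasChartDerivAt.unique {X : Type*} [MetricSpace X] {n : ℕ}
    {φ : X → EuclideanSpace ℝ (Fin n)} {f : X → ℝ} {x : X}
    {L L' : EuclideanSpace ℝ (Fin n) →L[ℝ] ℝ} (hφ : ¬ DependentAt (components φ) x)
    (h : HasChartDerivAt φ f x L) (h' : HasChartDerivAt φ f x L') : L = L' := by
  have key : ∀ (M : EuclideanSpace ℝ (Fin n) →L[ℝ] ℝ) (z : EuclideanSpace ℝ (Fin n)),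
      M z = ∑ i, M (EuclideanSpace.single i 1) * z i := by
    intro M z
    conv_lhs => rw [← (EuclideanSpace.basisFun (Fin n) ℝ).sum_repr z, map_sum]
    simp [mul_comm]
  by_contra hne
  refine hφ ⟨fun i => (L' - L) (EuclideanSpace.single i 1), fun h0 => hne ?_, ?_⟩
  · have : L' - L = 0 := by
      ext z
      rw [key]
      simp only [_root_.zero_apply]
      exact Finset.sum_eq_zero fun i _ => by rw [congrFun h0 i]; simp
    exact (sub_eq_zero.mp this).symm
  · refine (h.sub h').congr_left fun y => ?_
    have := key (L' - L) (φ y - φ x)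
    simp only [components, ← Finset.sum_sub_distrib, ← mul_sub]
    simp only [PiLp.sub_apply] at this
    rw [← this]
    simp only [_root_.sub_apply]
    ring

theorem HasChartDerivAt.comp {X : Type*} [MetricSpace X] {n m : ℕ} {F : Type*}
    [NormedAddCommGroup F] [NormedSpace ℝ F] {φ : X → EuclideanSpace ℝ (Fin n)}
    {ψ : X → EuclideanSpace ℝ (Fin m)} {f : X → F} {x : X}
    {L : EuclideanSpace ℝ (Fin m) →L[ℝ] F}
    {g : EuclideanSpace ℝ (Fin n) →L[ℝ] EuclideanSpace ℝ (Fin m)}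
    (h : HasChartDerivAt ψ f x L) (hg : HasChartDerivAt φ ψ x g) :
    HasChartDerivAt φ f x (L.comp g) := by
  refine (h.add ((L.isBigO_comp _ _).trans_isLittleO hg)).congr_left fun y => ?_
  simp only [map_sub, ContinuousLinearMap.comp_apply]
  abel

/-- A measurable differentiable structure on `(X, μ)`: a countable family of charts that covers
almost all of `X`. As usual, the domains are shrunk by null sets, so that at every point of a
domain the coordinates are independent, and at every point of an overlap the coordinates of each
chart are differentiable with respect to those of the other. -/
structure Atlas {X : Type*} [MetricSpace X] [MeasurableSpace X] (μ : Measure X) where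
  /-- the index set -/
  ι : Type
  countable : Countable ι
  /-- the domains of the charts -/
  U : ι → Set X
  /-- the dimensions of the charts -/
  N : ι → ℕ
  /-- the coordinate functions -/
  φ : ∀ α, X → EuclideanSpace ℝ (Fin (N α))
  isChart : ∀ α, IsChart μ (U α) (φ α)
  full : μ (⋃ α, U α)ᶜ = 0
  independent : ∀ α, ∀ x ∈ U α, ¬ DependentAt (components (φ α)) x
  compatible : ∀ α β, ∀ x ∈ U α ∩ U β, ChartDifferentiableAt (φ α) (φ β) x

namespace Atlas

variable {X : Type*} [MetricSpace X] [MeasurableSpace X] {μ : Measure X} (A : Atlas μ)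

/-- The transition function `g_{αβ}` of the tangent bundle at `x`: the derivative of the
coordinates `φ_β` with respect to `φ_α`. -/
def transition (α β : A.ι) (x : X) :
    EuclideanSpace ℝ (Fin (A.N α)) →L[ℝ] EuclideanSpace ℝ (Fin (A.N β)) :=
  chartDeriv (A.φ α) (A.φ β) x

/-- The fibre `T_y X` of the tangent bundle: families of vectors `v_α`, one for each chart around
`y`, that correspond to each other under the transition functions, `g_{αβ} v_α = v_β`. -/
def tangentSpace (y : X) :
    Submodule ℝ (∀ α : {α : A.ι // y ∈ A.U α}, EuclideanSpace ℝ (Fin (A.N α))) where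
  carrier := {v | ∀ α β : {α : A.ι // y ∈ A.U α}, A.transition α β y (v α) = v β}
  add_mem' := by
    intro v w hv hw α β
    simp only [Pi.add_apply, map_add, hv α β, hw α β]
  zero_mem' := by
    intro α β
    simp
  smul_mem' := by
    intro c v hv α β
    simp only [Pi.smul_apply, map_smul, hv α β]

open Classical in
/-- The differential `df|_y`, a linear function on `T_y X`, computed in any chart around `y`: on
`v` it is `∑ i, ∂f/∂φ_αⁱ (y) * v_αⁱ`; by `differential_apply` the chart does not matter. -/
def differential (f : X → ℝ) (y : X) : A.tangentSpace y →ₗ[ℝ] ℝ :=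
  if h : Nonempty {α : A.ι // y ∈ A.U α} then
    (chartDeriv (A.φ h.some) f y).toLinearMap ∘ₗ LinearMap.proj h.some ∘ₗ
      (A.tangentSpace y).subtype
  else 0

theorem differential_apply {f : X → ℝ} {y : X}
    (hf : ∀ α, y ∈ A.U α → ChartDifferentiableAt (A.φ α) f y) (v : A.tangentSpace y)
    (α : {α : A.ι // y ∈ A.U α}) :
    A.differential f y v = chartDeriv (A.φ α) f y (v.1 α) := by
  have h : Nonempty {α : A.ι // y ∈ A.U α} := ⟨α⟩
  rw [differential, dif_pos h]
  generalize h.some = β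
  simp only [LinearMap.comp_apply, LinearMap.proj_apply, Submodule.subtype_apply,
    ContinuousLinearMap.coe_coe]
  have hβ := (hf β β.2).hasChartDerivAt
  have hα := (hf α α.2).hasChartDerivAt
  have hg : HasChartDerivAt (A.φ β) (A.φ α) y (A.transition β α y) :=
    (A.compatible β α y ⟨β.2, α.2⟩).hasChartDerivAt
  rw [hβ.unique (A.independent β y β.2) (hα.comp hg), ContinuousLinearMap.comp_apply, v.2 β α]

/-- `V` is a `Φ`-differentiability set: a Borel subset of full measure of the union of the chart
domains, at the points of which all members of `Φ` are differentiable with respect to the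
coordinates. -/
structure IsDifferentiabilitySet (Φ : Set (X → ℝ)) (V : Set X) : Prop where
  measurableSet : MeasurableSet V
  subset : V ⊆ ⋃ α, A.U α
  full : μ ((⋃ α, A.U α) \ V) = 0
  differentiable : ∀ x ∈ V, ∀ f ∈ Φ, ∀ α, x ∈ A.U α → ChartDifferentiableAt (A.φ α) f x

/-- The seminorm `‖v‖_{D, ρ} = sup_{x ∈ D} |dρ_x|_y (v)|` on `T_y X`, where `ρ_x = ρ(x, ·)`. -/
def tangentSeminorm (ρ : PseudoMetric X ℝ) (D : Set X) (y : X) (v : A.tangentSpace y) : ℝ :=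
  ⨆ x : D, |A.differential (fun z => ρ x z) y v|

open Classical in
/-- The velocity vector `γ'(t) ∈ T_{γ(t)} X` of a map `γ` with domain `C`: in a chart `φ_α` around
`γ t` it is `(φ_α ∘ γ)'(t)`. It is set to `0` where these derivatives do not form a tangent
vector. -/
def velocity (γ : ℝ → X) (C : Set ℝ) (t : ℝ) : A.tangentSpace (γ t) :=
  if h : (fun α : {α : A.ι // γ t ∈ A.U α} => derivWithin (A.φ α ∘ γ) C t) ∈ A.tangentSpace (γ t)
  then ⟨_, h⟩ else 0

end Atlas

/-! ### Pseudometrics and their Hausdorff measure -/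

/-- The distance of `X`, as a bundled pseudometric. -/
def distPseudometric (X : Type*) [MetricSpace X] : PseudoMetric X ℝ where
  toFun := dist
  refl' := dist_self
  symm' := dist_comm
  triangle' := dist_triangle

/-- `ρ ≤ c * d` for some constant `c`. -/
def IsLipschitzCompatible {X : Type*} [MetricSpace X] (ρ : PseudoMetric X ℝ) : Prop :=
  ∃ c : ℝ, 0 ≤ c ∧ ∀ x y, ρ x y ≤ c * dist x y

/-- The distance functions `ρ_x = ρ(x, ·)` for `x ∈ D`. -/
def distanceFunctions {X : Type*} (ρ : PseudoMetric X ℝ) (D : Set X) : Set (X → ℝ) :=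
  {f | ∃ x ∈ D, f = fun z => ρ x z}

/-- A copy of `X`, to carry the pseudometric `ρ`. -/
@[nolint unusedArguments]
def WithPseudometric {X : Type*} (_ρ : PseudoMetric X ℝ) : Type _ := X

instance {X : Type*} (ρ : PseudoMetric X ℝ) : PseudoMetricSpace (WithPseudometric ρ) where
  dist := ρ.toFun
  dist_self := ρ.refl'
  dist_comm := ρ.symm'
  dist_triangle := ρ.triangle'

/-- The metric space `X / ρ` obtained from `X` by identifying points at `ρ`-distance `0`. -/
def MetricQuotient {X : Type*} (ρ : PseudoMetric X ℝ) : Type _ :=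
  SeparationQuotient (WithPseudometric ρ)

instance {X : Type*} (ρ : PseudoMetric X ℝ) : MetricSpace (MetricQuotient ρ) :=
  inferInstanceAs (MetricSpace (SeparationQuotient (WithPseudometric ρ)))

instance {X : Type*} (ρ : PseudoMetric X ℝ) : MeasurableSpace (MetricQuotient ρ) := borel _

instance {X : Type*} (ρ : PseudoMetric X ℝ) : BorelSpace (MetricQuotient ρ) := ⟨rfl⟩

/-- The projection `X → X / ρ`. -/
def toQuotient {X : Type*} (ρ : PseudoMetric X ℝ) (x : X) : MetricQuotient ρ :=
  SeparationQuotient.mk (X := WithPseudometric ρ) x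

theorem dist_toQuotient {X : Type*} (ρ : PseudoMetric X ℝ) (x y : X) :
    dist (toQuotient ρ x) (toQuotient ρ y) = ρ x y := rfl

/-- The `1`-dimensional Hausdorff measure associated to the pseudometric `ρ`. As `X → X / ρ`
preserves distances, it is the Hausdorff measure of the projection. -/
def hausdorff {X : Type*} (ρ : PseudoMetric X ℝ) (S : Set X) : ℝ≥0∞ :=
  Measure.hausdorffMeasure 1 (toQuotient ρ '' S)

/-- The `ρ`-length of `γ` on `C`: the `1`-dimensional Hausdorff measure of the image, counted with
multiplicity, `∫ #{t ∈ C | γ t = z} dℋ¹(z)`; points at `ρ`-distance `0` are identified. -/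
def length {X : Type*} (ρ : PseudoMetric X ℝ) (γ : ℝ → X) (C : Set ℝ) : ℝ≥0∞ :=
  ∫⁻ z, (({t | t ∈ C ∧ toQuotient ρ (γ t) = z}.encard : ℕ∞) : ℝ≥0∞)
    ∂(Measure.hausdorffMeasure 1 : Measure (MetricQuotient ρ))

/-- `m` is the `ρ`-metric differential at `t` of the map `γ` with domain `C`: as `s → ∞`, the
rescaled pullback pseudometrics `(x₁, x₂) ↦ s * ρ(γ(t + x₁ / s), γ(t + x₂ / s))` converge to
`m * |x₁ - x₂|`, uniformly on compact sets of pairs at which they are defined. -/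
def HasMetricDerivAt {X : Type*} (ρ : PseudoMetric X ℝ) (γ : ℝ → X) (C : Set ℝ) (t m : ℝ) : Prop :=
  0 ≤ m ∧ ∀ K : Set (ℝ × ℝ), IsCompact K → ∀ ε > 0, ∀ᶠ s : ℝ in atTop, ∀ x ∈ K,
    t + s⁻¹ * x.1 ∈ C → t + s⁻¹ * x.2 ∈ C →
      abs (s * ρ (γ (t + s⁻¹ * x.1)) (γ (t + s⁻¹ * x.2)) - m * abs (x.1 - x.2)) < ε

/-! ### Generic pairs -/

/-- `t` is a Lebesgue density point of `S`. -/
def IsDensityPoint (S : Set ℝ) (t : ℝ) : Prop :=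
  Tendsto (fun r : ℝ => volume (S ∩ Icc (t - r) (t + r)) / ENNReal.ofReal (2 * r)) (𝓝[>] 0) (𝓝 1)

/-- The function `g`, defined on `S`, is approximately continuous at the point `t` of `S`. -/
def ApproxContinuousAt (g : ℝ → ℝ) (S : Set ℝ) (t : ℝ) : Prop :=
  t ∈ S ∧ ∀ ε > 0, IsDensityPoint {s | s ∈ S ∧ |g s - g t| < ε} t

/-- The data with respect to which genericity is defined: countable collections of Lipschitz
functions, of bounded Borel functions, and of Lipschitz compatible pseudometrics including the
distance, and a countable dense subset `D`. -/
structure GenericityData (X : Type*) [MetricSpace X] [MeasurableSpace X] where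
  /-- the Lipschitz functions -/
  lip : Set (X → ℝ)
  lip_countable : lip.Countable
  lip_lipschitz : ∀ f ∈ lip, ∃ K, LipschitzWith K f
  /-- the bounded Borel functions -/
  bor : Set (X → ℝ)
  bor_countable : bor.Countable
  bor_measurable : ∀ u ∈ bor, Measurable u
  bor_bounded : ∀ u ∈ bor, ∃ b, ∀ x, |u x| ≤ b
  /-- the pseudometrics -/
  sem : Set (PseudoMetric X ℝ)
  sem_countable : sem.Countable
  sem_compatible : ∀ ρ ∈ sem, IsLipschitzCompatible ρ
  dist_mem : distPseudometric X ∈ sem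
  /-- the countable dense set -/
  D : Set X
  D_countable : D.Countable
  D_dense : Dense D

/-- The pair `(γ, t)` is generic, where `γ` is a fragment with domain `C`. -/
structure IsGenericPair {X : Type*} [MetricSpace X] [MeasurableSpace X] (G : GenericityData X)
    (γ : ℝ → X) (C : Set ℝ) (t : ℝ) : Prop where
  mem : t ∈ C
  density : IsDensityPoint C t
  lip : ∀ f ∈ G.lip, ApproxContinuousAt (derivWithin (f ∘ γ) C)
    {s | s ∈ C ∧ DifferentiableWithinAt ℝ (f ∘ γ) C s} t
  bor : ∀ u ∈ G.bor, ApproxContinuousAt (u ∘ γ) C t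
  distance : ∀ x ∈ G.D, ∀ ρ ∈ G.sem, ApproxContinuousAt (derivWithin (fun s => ρ x (γ s)) C)
    {s | s ∈ C ∧ DifferentiableWithinAt ℝ (fun s => ρ x (γ s)) C s} t
  sup_distance : ∀ ρ ∈ G.sem,
    ApproxContinuousAt (fun s => ⨆ x : G.D, |derivWithin (fun s => ρ x (γ s)) C s|)
      {s | s ∈ C ∧ ∀ x ∈ G.D, DifferentiableWithinAt ℝ (fun s => ρ x (γ s)) C s} t

/-- The fragment `γ` with domain `C` is generic, relative to the set `V`: at almost every `t ∈ C`
the pair `(γ, t)` is generic and `γ t ∈ V`. -/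
def IsGenericFragment {X : Type*} [MetricSpace X] [MeasurableSpace X] (G : GenericityData X)
    (V : Set X) (γ : ℝ → X) (C : Set ℝ) : Prop :=
  ∀ᵐ t, t ∈ C → IsGenericPair G γ C t ∧ γ t ∈ V

end MetricDiff

end

namespace MetricDiff

/-! ### Density points and approximate continuity -/

theorem volume_inter_Icc_div_le_one (S : Set ℝ) (t r : ℝ) :
    volume (S ∩ Icc (t - r) (t + r)) / ENNReal.ofReal (2 * r) ≤ 1 := by
  refine ENNReal.div_le_of_le_mul ?_
  rw [one_mul]
  refine (measure_mono inter_subset_right).trans_eq ?_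
  rw [Real.volume_Icc]
  ring_nf

theorem IsDensityPoint.mono {S T : Set ℝ} {t : ℝ} (h : IsDensityPoint S t) (hST : S ⊆ T) :
    IsDensityPoint T t := by
  refine tendsto_of_tendsto_of_tendsto_of_le_of_le' h tendsto_const_nhds ?_ ?_
  · exact Eventually.of_forall fun r => by gcongr
  · exact Eventually.of_forall fun r => volume_inter_Icc_div_le_one T t r

theorem ae_isDensityPoint {S : Set ℝ} (hS : NullMeasurableSet S) :
    ∀ᵐ t, t ∈ S → IsDensityPoint S t := by
  rw [← ae_restrict_iff'₀ hS]
  filter_upwards [Besicovitch.ae_tendsto_measure_inter_div volume S] with t ht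
  refine ht.congr fun r => ?_
  rw [Real.closedBall_eq_Icc, Real.volume_Icc]
  ring_nf

theorem ae_approxContinuousAt {g : ℝ → ℝ} {S : Set ℝ} (hS : NullMeasurableSet S)
    (hg : AEMeasurable g (volume.restrict S)) :
    ∀ᵐ t, t ∈ S → ApproxContinuousAt g S t := by
  have hmeas : ∀ q ε : ℝ, NullMeasurableSet {s | s ∈ S ∧ |g s - q| < ε} := by
    intro q ε
    have h1 : NullMeasurableSet {s | |g s - q| < ε} (volume.restrict S) :=
      nullMeasurableSet_lt (by fun_prop) aemeasurable_const
    have h2 := (nullMeasurableSet_restrict hS).1 h1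
    rwa [inter_comm] at h2
  have hae : ∀ᵐ t, ∀ q ε : ℚ, t ∈ {s | s ∈ S ∧ |g s - q| < ε} →
      IsDensityPoint {s | s ∈ S ∧ |g s - q| < ε} t :=
    ae_all_iff.2 fun q => ae_all_iff.2 fun ε => ae_isDensityPoint (hmeas q ε)
  filter_upwards [hae] with t ht htS
  refine ⟨htS, fun ε hε => ?_⟩
  obtain ⟨δ, hδ0, hδ⟩ := exists_rat_btwn (half_pos hε)
  obtain ⟨q, hq1, hq2⟩ := exists_rat_btwn (show g t - δ < g t + δ by linarith)
  refine (ht q δ ⟨htS, by rw [abs_lt]; constructor <;> linarith⟩).mono fun s hs => ⟨hs.1, ?_⟩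
  have h1 := abs_lt.1 hs.2
  rw [abs_lt]
  constructor <;> linarith [h1.1, h1.2]

theorem IsDensityPoint.accPt {S : Set ℝ} {t : ℝ} (h : IsDensityPoint S t) : AccPt t (𝓟 S) := by
  rw [accPt_iff_nhds]
  intro U hU
  by_contra! hne
  obtain ⟨δ, hδ, hδU⟩ := Metric.mem_nhds_iff.1 hU
  have h0 : Tendsto (fun r : ℝ => volume (S ∩ Icc (t - r) (t + r)) / ENNReal.ofReal (2 * r))
      (𝓝[>] 0) (𝓝 0) := by
    refine tendsto_const_nhds.congr' ?_
    filter_upwards [Ioo_mem_nhdsGT hδ] with r hr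
    have : S ∩ Icc (t - r) (t + r) ⊆ {t} := fun s hs =>
      hne s ⟨hδU (by
        rw [Metric.mem_ball, Real.dist_eq, abs_lt]
        constructor <;> linarith [hs.2.1, hs.2.2, hr.2]), hs.1⟩
    rw [measure_mono_null this (by simp), ENNReal.zero_div]
  exact zero_ne_one (tendsto_nhds_unique h0 h)

/-- At a density point of a measurable set, the complement has small measure at small scales. -/
theorem IsDensityPoint.eventually_volume_diff_le {S : Set ℝ} {t : ℝ} (h : IsDensityPoint S t)
    (hS : NullMeasurableSet S) {ε : ℝ} (hε : 0 < ε) :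
    ∀ᶠ r : ℝ in 𝓝[>] 0, volume (Icc (t - r) (t + r) \ S) ≤ ENNReal.ofReal (ε * r) := by
  have h1 : ∀ᶠ r : ℝ in 𝓝[>] 0, 1 - ENNReal.ofReal (ε / 2) <
      volume (S ∩ Icc (t - r) (t + r)) / ENNReal.ofReal (2 * r) := by
    refine h.eventually_const_lt (ENNReal.sub_lt_self (by simp) (by simp) ?_)
    simpa using half_pos hε
  filter_upwards [h1, self_mem_nhdsWithin] with r hr hr0
  have hr0 : 0 < r := hr0
  have hvol : volume (Icc (t - r) (t + r)) = ENNReal.ofReal (2 * r) := by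
    rw [Real.volume_Icc]; ring_nf
  have hpos : ENNReal.ofReal (2 * r) ≠ 0 := by simpa using hr0
  have hsplit := measure_inter_add_sdiff₀ (μ := volume) (Icc (t - r) (t + r)) hS
  rw [hvol, inter_comm] at hsplit
  rw [ENNReal.lt_div_iff_mul_lt (Or.inl hpos) (Or.inl ENNReal.ofReal_ne_top),
    ENNReal.sub_mul fun _ _ => ENNReal.ofReal_ne_top, one_mul, ← ENNReal.ofReal_mul (by positivity)] at hr
  have h2 : ENNReal.ofReal (2 * r) ≤
      volume (S ∩ Icc (t - r) (t + r)) + ENNReal.ofReal (ε / 2 * (2 * r)) :=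
    tsub_le_iff_right.1 hr.le
  rw [← hsplit] at h2
  have h3 := ENNReal.le_of_add_le_add_left
    (ne_top_of_le_ne_top ENNReal.ofReal_ne_top (hsplit ▸ le_self_add)) h2
  refine h3.trans_eq ?_
  ring_nf

/-! ### Lipschitz functions on closed subsets of the line -/

theorem abs_le_of_hasDerivWithinAt_of_lipschitzOnWith {f : ℝ → ℝ} {C : Set ℝ} {t f' : ℝ} {L : ℝ≥0}
    (hf : HasDerivWithinAt f f' C t) (hL : LipschitzOnWith L f C) (ht : t ∈ C)
    (hacc : AccPt t (𝓟 C)) : |f'| ≤ L := by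
  have hne : (𝓝[C \ {t}] t).NeBot := by
    rwa [accPt_principal_iff_nhdsWithin] at hacc
  refine le_of_tendsto (hasDerivWithinAt_iff_tendsto_slope.1 hf).abs ?_
  filter_upwards [self_mem_nhdsWithin] with s hs
  have h1 : 0 < |s - t| := abs_pos.2 (sub_ne_zero.2 hs.2)
  rw [slope_def_field, abs_div, div_le_iff₀ h1]
  exact hL.dist_le_mul s hs.1 t ht

theorem ae_accPt_of_measurableSet {C : Set ℝ} (hC : MeasurableSet C) :
    ∀ᵐ t, t ∈ C → AccPt t (𝓟 C) :=
  (ae_isDensityPoint hC.nullMeasurableSet).mono fun _ h ht => (h ht).accPt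

/-- Almost everywhere on `C`, a function that is Lipschitz on `C` is differentiable within `C`, with
the derivative of any Lipschitz extension. -/
theorem ae_hasDerivWithinAt_of_eqOn {f h : ℝ → ℝ} {C : Set ℝ} {L : ℝ≥0}
    (hh : LipschitzWith L h) (hfh : EqOn f h C) :
    ∀ᵐ t, t ∈ C → HasDerivWithinAt f (deriv h t) C t := by
  filter_upwards [hh.ae_differentiableAt_real] with t hd ht
  exact hd.hasDerivAt.hasDerivWithinAt.congr hfh (hfh ht)

theorem ae_derivWithin_eq_of_eqOn {f h : ℝ → ℝ} {C : Set ℝ} (hC : MeasurableSet C) {L : ℝ≥0}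
    (hh : LipschitzWith L h) (hfh : EqOn f h C) :
    ∀ᵐ t, t ∈ C → derivWithin f C t = deriv h t := by
  filter_upwards [ae_hasDerivWithinAt_of_eqOn hh hfh, ae_accPt_of_measurableSet hC] with t hd hacc ht
  exact (hd ht).derivWithin (uniqueDiffWithinAt_iff_accPt.2 (hacc ht))

theorem ae_differentiableWithinAt_of_lipschitzOnWith {f : ℝ → ℝ} {C : Set ℝ} {L : ℝ≥0}
    (hf : LipschitzOnWith L f C) :
    ∀ᵐ t, t ∈ C → DifferentiableWithinAt ℝ f C t := by
  obtain ⟨h, hh, hfh⟩ := hf.extend_real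
  exact (ae_hasDerivWithinAt_of_eqOn hh hfh).mono fun t ht htC => (ht htC).differentiableWithinAt

theorem aemeasurable_derivWithin_of_lipschitzOnWith {f : ℝ → ℝ} {C : Set ℝ}
    (hC : MeasurableSet C) {L : ℝ≥0} (hf : LipschitzOnWith L f C) :
    AEMeasurable (derivWithin f C) (volume.restrict C) := by
  obtain ⟨h, hh, hfh⟩ := hf.extend_real
  refine ⟨deriv h, measurable_deriv h, ?_⟩
  rw [EventuallyEq, ae_restrict_iff' hC]
  exact ae_derivWithin_eq_of_eqOn hC hh hfh

theorem nullMeasurableSet_of_ae_mem {C : Set ℝ} (hC : MeasurableSet C) {p : ℝ → Prop}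
    (hp : ∀ᵐ t, t ∈ C → p t) : NullMeasurableSet {s | s ∈ C ∧ p s} := by
  refine hC.nullMeasurableSet.congr ?_
  filter_upwards [hp] with t ht
  exact propext ⟨fun h => ⟨h, ht h⟩, fun h => h.1⟩

theorem ae_approxContinuousAt_of_ae {C : Set ℝ} (hC : MeasurableSet C) {p : ℝ → Prop}
    (hp : ∀ᵐ t, t ∈ C → p t) {g : ℝ → ℝ} (hg : AEMeasurable g (volume.restrict C)) :
    ∀ᵐ t, t ∈ C → ApproxContinuousAt g {s | s ∈ C ∧ p s} t := by
  filter_upwards [ae_approxContinuousAt (nullMeasurableSet_of_ae_mem hC hp)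
    (hg.mono_measure (Measure.restrict_mono (fun s hs => hs.1) le_rfl)), hp] with t h1 h2 ht
  exact h1 ⟨ht, h2 ht⟩

theorem enorm_sub_le_lintegral_deriv {h : ℝ → ℝ} {L : ℝ≥0} (hh : LipschitzWith L h) {a b : ℝ}
    (hab : a ≤ b) : ‖h b - h a‖ₑ ≤ ∫⁻ s in Icc a b, ‖deriv h s‖ₑ := by
  rw [← (hh.lipschitzOnWith.absolutelyContinuousOnInterval (a := a) (b := b)).integral_deriv_eq_sub,
    intervalIntegral.integral_of_le hab]
  exact (enorm_integral_le_lintegral_enorm _).trans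
    (lintegral_mono_set Ioc_subset_Icc_self)

/-! ### The speed of a curve fragment, computed with distance functions -/

section Speed

variable {Y : Type*} [PseudoMetricSpace Y] {ι : Type*} {η : ℝ → Y} {C : Set ℝ} {L : ℝ≥0}

theorem lipschitzOnWith_dist_comp (hη : LipschitzOnWith L η C) (y : Y) :
    LipschitzOnWith L (fun s => dist y (η s)) C := by
  have h := (LipschitzWith.dist_right y).comp_lipschitzOnWith hη
  rwa [one_mul] at h

/-- The supremum of the absolute values of the derivatives of the distances from the points `p i`
along the map `η` with domain `C`. -/
noncomputable def supSpeed (p : ι → Y) (η : ℝ → Y) (C : Set ℝ) (t : ℝ) : ℝ :=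
  ⨆ i, |derivWithin (fun s => dist (p i) (η s)) C t|

theorem aemeasurable_supSpeed [Countable ι] (p : ι → Y) (hC : MeasurableSet C)
    (hη : LipschitzOnWith L η C) : AEMeasurable (supSpeed p η C) (volume.restrict C) :=
  AEMeasurable.iSup fun i =>
    (aemeasurable_derivWithin_of_lipschitzOnWith hC (lipschitzOnWith_dist_comp hη (p i))).abs

theorem supSpeed_nonneg (p : ι → Y) (t : ℝ) : 0 ≤ supSpeed p η C t :=
  Real.iSup_nonneg fun _ => abs_nonneg _

theorem abs_derivWithin_le_supSpeed {p : ι → Y} {t : ℝ} (hη : LipschitzOnWith L η C) (ht : t ∈ C)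
    (hacc : AccPt t (𝓟 C))
    (hd : ∀ i, DifferentiableWithinAt ℝ (fun s => dist (p i) (η s)) C t) (i : ι) :
    |derivWithin (fun s => dist (p i) (η s)) C t| ≤ supSpeed p η C t := by
  refine le_ciSup (f := fun i => |derivWithin (fun s => dist (p i) (η s)) C t|) ⟨L, ?_⟩ i
  rintro _ ⟨j, rfl⟩
  exact abs_le_of_hasDerivWithinAt_of_lipschitzOnWith (hd j).hasDerivWithinAt
    (lipschitzOnWith_dist_comp hη (p j)) ht hacc

theorem ae_differentiableWithinAt_dist [Countable ι] (p : ι → Y) (hη : LipschitzOnWith L η C) :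
    ∀ᵐ t, t ∈ C → ∀ i, DifferentiableWithinAt ℝ (fun s => dist (p i) (η s)) C t := by
  have := ae_all_iff.2 fun i =>
    ae_differentiableWithinAt_of_lipschitzOnWith (lipschitzOnWith_dist_comp hη (p i))
  filter_upwards [this] with t ht htC i
  exact ht i htC

theorem ae_approxContinuousAt_supSpeed [Countable ι] (p : ι → Y) (hC : MeasurableSet C)
    (hη : LipschitzOnWith L η C) :
    ∀ᵐ t, t ∈ C → ApproxContinuousAt (supSpeed p η C)
      {s | s ∈ C ∧ ∀ i, DifferentiableWithinAt ℝ (fun s => dist (p i) (η s)) C s} t :=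
  ae_approxContinuousAt_of_ae hC (ae_differentiableWithinAt_dist p hη)
    (aemeasurable_supSpeed p hC hη)

/-- The increment of a Lipschitz function on `[a, b]`, if its derivative is at most `M` on `A`. -/
theorem abs_sub_le_of_abs_deriv_le {h : ℝ → ℝ} (hh : LipschitzWith L h) {A : Set ℝ} {M : ℝ}
    (hM : 0 ≤ M) (hA : ∀ᵐ s, s ∈ A → |deriv h s| ≤ M) {a b δ : ℝ} (hδ : 0 ≤ δ) (hab : a ≤ b)
    (hvol : volume (Icc a b \ A) ≤ ENNReal.ofReal δ) :
    |h b - h a| ≤ M * (b - a) + L * δ := by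
  have hb : ∀ᵐ s ∂volume.restrict (Icc a b),
      ‖deriv h s‖ₑ ≤ ENNReal.ofReal M + (Icc a b \ A).indicator (fun _ => (L : ℝ≥0∞)) s := by
    filter_upwards [ae_restrict_of_ae hA, ae_restrict_mem measurableSet_Icc] with s hs hsab
    by_cases hsA : s ∈ A
    · refine le_add_right ?_
      rw [Real.enorm_eq_ofReal_abs]
      exact ENNReal.ofReal_le_ofReal (hs hsA)
    · refine le_add_left ?_
      rw [indicator_of_mem (show s ∈ Icc a b \ A from ⟨hsab, hsA⟩), enorm_eq_nnnorm]
      exact_mod_cast norm_deriv_le_of_lipschitz hh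
  have key : ‖h b - h a‖ₑ ≤ ENNReal.ofReal (M * (b - a) + L * δ) := by
    calc ‖h b - h a‖ₑ ≤ ∫⁻ s in Icc a b, ‖deriv h s‖ₑ := enorm_sub_le_lintegral_deriv hh hab
      _ ≤ ∫⁻ s in Icc a b,
          (ENNReal.ofReal M + (Icc a b \ A).indicator (fun _ => (L : ℝ≥0∞)) s) :=
        lintegral_mono_ae hb
      _ = ENNReal.ofReal M * volume (Icc a b) +
          ∫⁻ s in Icc a b, (Icc a b \ A).indicator (fun _ => (L : ℝ≥0∞)) s := by
        rw [lintegral_add_left measurable_const, setLIntegral_const]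
      _ ≤ ENNReal.ofReal M * ENNReal.ofReal (b - a) + L * ENNReal.ofReal δ := by
        rw [Real.volume_Icc]
        gcongr
        refine (lintegral_indicator_const_le _ _).trans ?_
        gcongr
        exact (Measure.restrict_apply_le _ _).trans hvol
      _ = ENNReal.ofReal (M * (b - a) + L * δ) := by
        rw [ENNReal.ofReal_add (mul_nonneg hM (sub_nonneg.2 hab)) (by positivity),
          ENNReal.ofReal_mul hM, ENNReal.ofReal_mul L.coe_nonneg, ENNReal.ofReal_coe_nnreal]
  rw [Real.enorm_eq_ofReal_abs] at key
  exact (ENNReal.ofReal_le_ofReal_iff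
    (add_nonneg (mul_nonneg hM (sub_nonneg.2 hab)) (by positivity))).1 key

theorem eventually_dist_le [Countable ι] {p : ι → Y} (hp : DenseRange p) (hC : MeasurableSet C)
    (hη : LipschitzOnWith L η C) {t : ℝ}
    (ht : ApproxContinuousAt (supSpeed p η C)
      {s | s ∈ C ∧ ∀ i, DifferentiableWithinAt ℝ (fun s => dist (p i) (η s)) C s} t)
    {ε : ℝ} (hε : 0 < ε) :
    ∀ᶠ r : ℝ in 𝓝[>] 0, ∀ a ∈ C ∩ Icc (t - r) (t + r), ∀ b ∈ C ∩ Icc (t - r) (t + r),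
      dist (η a) (η b) ≤ supSpeed p η C t * |a - b| + ε * r := by
  set S := {s | s ∈ C ∧ ∀ i, DifferentiableWithinAt ℝ (fun s => dist (p i) (η s)) C s}
  set m := supSpeed p η C t
  have hm : 0 ≤ m := supSpeed_nonneg p t
  set δ : ℝ := ε / (2 + L) with hδdef
  have hδ : 0 < δ := by positivity
  set A := {s | s ∈ S ∧ |supSpeed p η C s - m| < δ}
  have hSnull : NullMeasurableSet S :=
    nullMeasurableSet_of_ae_mem hC (ae_differentiableWithinAt_dist p hη)
  have hA : NullMeasurableSet A := by
    have h1 : NullMeasurableSet {s | |supSpeed p η C s - m| < δ} (volume.restrict S) := by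
      have := (aemeasurable_supSpeed p hC hη).mono_measure
        (Measure.restrict_mono (show S ⊆ C from fun s hs => hs.1) le_rfl)
      exact nullMeasurableSet_lt (by fun_prop) aemeasurable_const
    have h2 := (nullMeasurableSet_restrict hSnull).1 h1
    rwa [inter_comm] at h2
  filter_upwards [(ht.2 δ hδ).eventually_volume_diff_le hA hδ, self_mem_nhdsWithin] with r hr hr0
  have hr0 : 0 < r := hr0
  have hle : ∀ a ∈ C ∩ Icc (t - r) (t + r), ∀ b ∈ C ∩ Icc (t - r) (t + r), a ≤ b →
      dist (η a) (η b) ≤ m * (b - a) + ε * r := by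
    intro a ha b hb hab
    have hi : ∀ i, |dist (p i) (η b) - dist (p i) (η a)| ≤ (m + δ) * (b - a) + L * (δ * r) := by
      intro i
      obtain ⟨h, hh, hfh⟩ := (lipschitzOnWith_dist_comp hη (p i)).extend_real
      have h1 : ∀ᵐ s, s ∈ A → |deriv h s| ≤ m + δ := by
        filter_upwards [ae_derivWithin_eq_of_eqOn hC hh hfh, ae_accPt_of_measurableSet hC]
          with s hs hacc hsA
        have h2 := abs_derivWithin_le_supSpeed hη hsA.1.1 (hacc hsA.1.1) hsA.1.2 i
        rw [hs hsA.1.1] at h2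
        linarith [(abs_lt.1 hsA.2).2]
      have h3 := abs_sub_le_of_abs_deriv_le hh (by positivity) h1 (mul_nonneg hδ.le hr0.le) hab
        ((measure_mono (sdiff_le_sdiff_right (Icc_subset_Icc ha.2.1 hb.2.2))).trans hr)
      rwa [← hfh ha.1, ← hfh hb.1] at h3
    have hba : b - a ≤ 2 * r := by linarith [ha.2.1, hb.2.2]
    have hbound : (m + δ) * (b - a) + L * (δ * r) ≤ m * (b - a) + ε * r := by
      have h1 : δ * (2 + L) = ε := by rw [hδdef]; field_simp
      have h2 : δ * (b - a) ≤ δ * (2 * r) := by gcongr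
      nlinarith
    refine le_of_forall_pos_le_add fun κ hκ => ?_
    obtain ⟨i, hi'⟩ := hp.exists_dist_lt (η a) (half_pos hκ)
    have h4 := (abs_le.1 (hi i)).2
    have h5 := dist_triangle (η a) (p i) (η b)
    rw [dist_comm] at hi'
    rw [dist_comm (η a) (p i)] at h5
    linarith
  intro a ha b hb
  rcases le_total a b with hab | hab
  · rw [abs_sub_comm, abs_of_nonneg (sub_nonneg.2 hab)]
    exact hle a ha b hb hab
  · rw [dist_comm, abs_of_nonneg (sub_nonneg.2 hab)]
    exact hle b hb a ha hab

theorem eventually_le_dist [Nonempty ι] {p : ι → Y} {t : ℝ}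
    (hd : ∀ i, DifferentiableWithinAt ℝ (fun s => dist (p i) (η s)) C t)
    {ε : ℝ} (hε : 0 < ε) :
    ∀ᶠ r : ℝ in 𝓝[>] 0, ∀ a ∈ C ∩ Icc (t - r) (t + r), ∀ b ∈ C ∩ Icc (t - r) (t + r),
      supSpeed p η C t * |a - b| ≤ dist (η a) (η b) + ε * r := by
  set m := supSpeed p η C t
  obtain ⟨i, hi⟩ := exists_lt_of_lt_ciSup (show m - ε / 4 < m by linarith)
  set f := fun s => dist (p i) (η s)
  set D := derivWithin f C t
  have h1 : ∀ᶠ s in 𝓝[C] t, ‖f s - f t - (s - t) • D‖ ≤ ε / 4 * ‖s - t‖ :=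
    (hasDerivWithinAt_iff_isLittleO.1 (hd i).hasDerivWithinAt).def (by positivity)
  obtain ⟨r₀, hr₀, hball⟩ := Metric.mem_nhdsWithin_iff.1 h1
  filter_upwards [Ioo_mem_nhdsGT hr₀] with r hr a ha b hb
  have key : ∀ s ∈ C ∩ Icc (t - r) (t + r), |f s - f t - (s - t) * D| ≤ ε / 4 * r := by
    intro s hs
    have h2 : |s - t| ≤ r := abs_le.2 ⟨by linarith [hs.2.1], by linarith [hs.2.2]⟩
    have h3 : ‖f s - f t - (s - t) • D‖ ≤ ε / 4 * ‖s - t‖ :=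
      hball ⟨by rw [Metric.mem_ball, Real.dist_eq]; exact h2.trans_lt hr.2, hs.1⟩
    rw [smul_eq_mul, Real.norm_eq_abs, Real.norm_eq_abs] at h3
    exact h3.trans (by gcongr)
  have hab : |a - b| ≤ 2 * r :=
    abs_le.2 ⟨by linarith [ha.2.1, hb.2.2], by linarith [ha.2.2, hb.2.1]⟩
  have h4 : |f a - f b| ≤ dist (η a) (η b) := by
    simp only [f, dist_comm (p i)]
    exact abs_dist_sub_le _ _ _
  have h5 : |D| * |a - b| ≤ |f a - f b| + ε / 2 * r := by
    have ha' := abs_le.1 (key a ha)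
    have hb' := abs_le.1 (key b hb)
    have hfa := abs_le.1 (le_refl |f a - f b|)
    rw [← abs_mul]
    refine abs_le.2 ⟨?_, ?_⟩ <;> nlinarith
  have h6 : m - ε / 4 < |D| := hi
  have h7 : (m - ε / 4) * |a - b| ≤ |D| * |a - b| := by gcongr
  nlinarith [abs_nonneg (a - b)]

theorem eventually_abs_dist_sub_le [Countable ι] [Nonempty ι] {p : ι → Y} (hp : DenseRange p)
    (hC : MeasurableSet C) (hη : LipschitzOnWith L η C) {t : ℝ}
    (ht : ApproxContinuousAt (supSpeed p η C)
      {s | s ∈ C ∧ ∀ i, DifferentiableWithinAt ℝ (fun s => dist (p i) (η s)) C s} t)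
    {ε : ℝ} (hε : 0 < ε) :
    ∀ᶠ r : ℝ in 𝓝[>] 0, ∀ a ∈ C ∩ Icc (t - r) (t + r), ∀ b ∈ C ∩ Icc (t - r) (t + r),
      abs (dist (η a) (η b) - supSpeed p η C t * |a - b|) ≤ ε * r := by
  filter_upwards [eventually_dist_le hp hC hη ht hε, eventually_le_dist ht.1.2 hε]
    with r h1 h2 a ha b hb
  exact abs_le.2 ⟨by linarith [h2 a ha b hb], by linarith [h1 a ha b hb]⟩

end Speed

theorem hasMetricDerivAt_of_eventually {X : Type*} {ρ : PseudoMetric X ℝ} {γ : ℝ → X} {C : Set ℝ}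
    {t m : ℝ} (hm : 0 ≤ m)
    (h : ∀ ε > 0, ∀ᶠ r : ℝ in 𝓝[>] 0, ∀ a ∈ C ∩ Icc (t - r) (t + r),
      ∀ b ∈ C ∩ Icc (t - r) (t + r), abs (ρ (γ a) (γ b) - m * |a - b|) ≤ ε * r) :
    HasMetricDerivAt ρ γ C t m := by
  refine ⟨hm, fun K hK ε hε => ?_⟩
  obtain ⟨R, hR0, hR⟩ := hK.isBounded.exists_pos_norm_le
  have hlim : Tendsto (fun s : ℝ => R * s⁻¹) atTop (𝓝[>] 0) := by
    refine tendsto_nhdsWithin_iff.2 ⟨by simpa using tendsto_inv_atTop_zero.const_mul R, ?_⟩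
    filter_upwards [eventually_gt_atTop 0] with s hs
    exact mul_pos hR0 (inv_pos.2 hs)
  filter_upwards [hlim.eventually (h (ε / (2 * R)) (by positivity)), eventually_gt_atTop 0]
    with s hs hs0 x hx h1 h2
  have hmem : ∀ z : ℝ, |z| ≤ R → t + s⁻¹ * z ∈ Icc (t - R * s⁻¹) (t + R * s⁻¹) := by
    intro z hz
    have hz' := abs_le.1 hz
    have := inv_pos.2 hs0
    constructor <;> nlinarith
  have hxR := hR x hx
  have h3 := hs _ ⟨h1, hmem _ ((norm_fst_le x).trans hxR)⟩ _ ⟨h2, hmem _ ((norm_snd_le x).trans hxR)⟩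
  have h4 : |t + s⁻¹ * x.1 - (t + s⁻¹ * x.2)| = s⁻¹ * |x.1 - x.2| := by
    rw [show t + s⁻¹ * x.1 - (t + s⁻¹ * x.2) = s⁻¹ * (x.1 - x.2) by ring, abs_mul,
      abs_of_pos (inv_pos.2 hs0)]
  rw [h4] at h3
  have h5 : s * ρ (γ (t + s⁻¹ * x.1)) (γ (t + s⁻¹ * x.2)) - m * |x.1 - x.2| =
      s * (ρ (γ (t + s⁻¹ * x.1)) (γ (t + s⁻¹ * x.2)) - m * (s⁻¹ * |x.1 - x.2|)) := by
    field_simp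
  rw [h5, abs_mul, abs_of_pos hs0]
  calc s * _ ≤ s * (ε / (2 * R) * (R * s⁻¹)) := by gcongr
    _ = ε / 2 := by field_simp
    _ < ε := half_lt_self hε

/-! ### The area formula for curve fragments in metric spaces -/

/-- The multiplicity function of a map that is injective on each of countably many disjoint sets. -/
theorem encard_eq_tsum_indicator {Y : Type*} {η : ℝ → Y} {E : ℕ → Set ℝ} (hdisj : Pairwise (Function.onFun Disjoint E))
    (hinj : ∀ i, InjOn η (E i)) (z : Y) :
    (({t | t ∈ ⋃ i, E i ∧ η t = z}.encard : ℕ∞) : ℝ≥0∞) =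
      ∑' i, (η '' E i).indicator (fun _ => (1 : ℝ≥0∞)) z := by
  have hunion : {t | t ∈ ⋃ i, E i ∧ η t = z} = ⋃ i, {t | t ∈ E i ∧ η t = z} := by
    ext t; simp
  have hsub : ∀ i, {t | t ∈ E i ∧ η t = z}.Subsingleton := fun i s hs t ht =>
    hinj i hs.1 ht.1 (hs.2.trans ht.2.symm)
  have hmeas : ∀ i, MeasurableSet {t | t ∈ E i ∧ η t = z} := fun i => (hsub i).measurableSet
  rw [hunion, ← Measure.count_apply (.iUnion hmeas), measure_iUnion]
  · refine tsum_congr fun i => ?_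
    rw [Measure.count_apply (hmeas i)]
    by_cases hz : z ∈ η '' E i
    · obtain ⟨t, ht, rfl⟩ := hz
      rw [indicator_of_mem (mem_image_of_mem η ht)]
      have : {s | s ∈ E i ∧ η s = η t} = {t} :=
        (hsub i).eq_singleton_of_mem ⟨ht, rfl⟩
      simp [this]
    · rw [indicator_of_notMem hz]
      have : {s | s ∈ E i ∧ η s = z} = ∅ :=
        eq_empty_of_forall_notMem fun s hs => hz ⟨s, hs.1, hs.2⟩
      simp [this]
  · exact fun i j hij => (hdisj hij).mono (fun t ht => ht.1) fun t ht => ht.1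
  · exact hmeas

section Area

variable {Y : Type*} [MetricSpace Y] {η : ℝ → Y} {C : Set ℝ} {L : ℝ≥0}

/-- `m` is the limit of the difference quotients `dist (η s) (η t) / |s - t|` as `s → t` in `C`. -/
def HasSpeedAt (η : ℝ → Y) (C : Set ℝ) (t m : ℝ) : Prop :=
  ∀ ε > 0, ∃ δ > 0, ∀ s ∈ C, |s - t| < δ → abs (dist (η s) (η t) - m * |s - t|) ≤ ε * |s - t|

theorem isClosed_setOf_dist_le (hC : IsClosed C) (hη : ContinuousOn η C) (c δ : ℝ) :
    IsClosed {t | t ∈ C ∧ ∀ s ∈ C, |s - t| < δ → dist (η s) (η t) ≤ c * |s - t|} := by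
  have h : {t | t ∈ C ∧ ∀ s ∈ C, |s - t| < δ → dist (η s) (η t) ≤ c * |s - t|} =
      C ∩ ⋂ s ∈ C, ({t ∈ C | δ ≤ |s - t|} ∪ {t ∈ C | dist (η s) (η t) ≤ c * |s - t|}) := by
    ext t
    simp only [mem_inter_iff, mem_iInter, mem_union, mem_ofPred_eq]
    refine and_congr_right fun ht => forall₂_congr fun s _ => ?_
    rw [← not_lt (b := δ)]
    tauto
  rw [h]
  refine hC.inter (isClosed_biInter fun s _ => ?_)
  exact (hC.isClosed_le (by fun_prop) (by fun_prop)).union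
    (hC.isClosed_le (by fun_prop) (by fun_prop))

theorem isClosed_setOf_le_dist (hC : IsClosed C) (hη : ContinuousOn η C) (c δ : ℝ) :
    IsClosed {t | t ∈ C ∧ ∀ s ∈ C, |s - t| < δ → c * |s - t| ≤ dist (η s) (η t)} := by
  have h : {t | t ∈ C ∧ ∀ s ∈ C, |s - t| < δ → c * |s - t| ≤ dist (η s) (η t)} =
      C ∩ ⋂ s ∈ C, ({t ∈ C | δ ≤ |s - t|} ∪ {t ∈ C | c * |s - t| ≤ dist (η s) (η t)}) := by
    ext t
    simp only [mem_inter_iff, mem_iInter, mem_union, mem_ofPred_eq]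
    refine and_congr_right fun ht => forall₂_congr fun s _ => ?_
    rw [← not_lt (b := δ)]
    tauto
  rw [h]
  refine hC.inter (isClosed_biInter fun s _ => ?_)
  exact (hC.isClosed_le (by fun_prop) (by fun_prop)).union
    (hC.isClosed_le (by fun_prop) (by fun_prop))

theorem abs_sub_lt_of_floor_div_eq {s t δ : ℝ} (hδ : 0 < δ) (h : ⌊s / δ⌋ = ⌊t / δ⌋) :
    |s - t| < δ := by
  have h1 := Int.abs_sub_lt_one_of_floor_eq_floor h
  rwa [← sub_div, abs_div, abs_of_pos hδ, div_lt_one hδ] at h1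

theorem measurableSet_floor_div_eq (δ : ℝ) (j : ℤ) : MeasurableSet {t : ℝ | ⌊t / δ⌋ = j} :=
  (Int.measurable_floor.comp (measurable_id.div_const δ)) (measurableSet_singleton j)

/-- A decomposition of a set on which the speed is positive into pieces on which it is almost
constant, and the map is almost a homothety. -/
theorem exists_bilipschitz_decomposition (hC : IsClosed C) (hη : ContinuousOn η C) {m : ℝ → ℝ}
    (hm : Measurable m) {P : Set ℝ} (hP : MeasurableSet P) (hPC : P ⊆ C) (hpos : ∀ t ∈ P, 0 < m t)
    (hspeed : ∀ t ∈ P, HasSpeedAt η C t (m t)) {l : ℝ} (hl : 1 < l) :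
    ∃ (E : ℕ → Set ℝ) (c : ℕ → ℝ), (∀ i, MeasurableSet (E i)) ∧ Pairwise (Function.onFun Disjoint E) ∧
      ⋃ i, E i = P ∧ (∀ i, 0 < c i) ∧ (∀ i, ∀ t ∈ E i, c i ≤ m t ∧ m t ≤ l * c i) ∧
      ∀ i, ∀ s ∈ E i, ∀ t ∈ E i,
        l⁻¹ * c i * |s - t| ≤ dist (η s) (η t) ∧ dist (η s) (η t) ≤ l ^ 2 * c i * |s - t| := by
  have hl0 : 0 < l := one_pos.trans hl
  set F : ℤ × ℕ × ℤ → Set ℝ := fun x =>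
    (P ∩ {t | m t ∈ Ico (l ^ x.1) (l ^ (x.1 + 1))}) ∩
    ({t | t ∈ C ∧ ∀ s ∈ C, |s - t| < 1 / ((x.2.1 : ℝ) + 1) →
        l⁻¹ * l ^ x.1 * |s - t| ≤ dist (η s) (η t)} ∩
      {t | t ∈ C ∧ ∀ s ∈ C, |s - t| < 1 / ((x.2.1 : ℝ) + 1) →
        dist (η s) (η t) ≤ l ^ 2 * l ^ x.1 * |s - t|}) ∩
      {t | ⌊t / (1 / ((x.2.1 : ℝ) + 1))⌋ = x.2.2}
  have hFm : ∀ x, MeasurableSet (F x) := fun x =>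
    ((hP.inter (hm measurableSet_Ico)).inter
      ((isClosed_setOf_le_dist hC hη _ _).measurableSet.inter
        (isClosed_setOf_dist_le hC hη _ _).measurableSet)).inter
      (measurableSet_floor_div_eq _ _)
  have hFP : ⋃ x, F x = P := by
    refine Subset.antisymm (iUnion_subset fun x t ht => ht.1.1.1) fun t ht => ?_
    obtain ⟨k, hk⟩ := exists_mem_Ico_zpow (hpos t ht) hl
    have hlk : 0 < l ^ k := zpow_pos hl0 k
    have hlk1 : l ^ (k + 1) = l * l ^ k := by rw [zpow_add_one₀ hl0.ne', mul_comm]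
    have hinv : l⁻¹ < 1 := inv_lt_one_of_one_lt₀ hl
    obtain ⟨δ, hδ, h⟩ := hspeed t ht (min (l ^ k - l⁻¹ * l ^ k) (l ^ 2 * l ^ k - l * l ^ k))
      (lt_min (by nlinarith) (by nlinarith [mul_pos hl0 hlk]))
    obtain ⟨n, hn⟩ := exists_nat_one_div_lt hδ
    refine mem_iUnion.2 ⟨(k, n, ⌊t / (1 / ((n : ℝ) + 1))⌋), ⟨⟨ht, hk⟩, ⟨hPC ht, ?_⟩, hPC ht, ?_⟩,
      rfl⟩
    · intro s hs hst
      have h1 := (abs_le.1 (h s hs (hst.trans hn))).1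
      have h2 : min (l ^ k - l⁻¹ * l ^ k) (l ^ 2 * l ^ k - l * l ^ k) * |s - t| ≤
          (l ^ k - l⁻¹ * l ^ k) * |s - t| := by gcongr; exact min_le_left _ _
      have h3 : l ^ k * |s - t| ≤ m t * |s - t| := by gcongr; exact hk.1
      dsimp only
      linarith
    · intro s hs hst
      have h1 := (abs_le.1 (h s hs (hst.trans hn))).2
      have h2 : min (l ^ k - l⁻¹ * l ^ k) (l ^ 2 * l ^ k - l * l ^ k) * |s - t| ≤
          (l ^ 2 * l ^ k - l * l ^ k) * |s - t| := by gcongr; exact min_le_right _ _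
      have h3 : m t * |s - t| ≤ l * l ^ k * |s - t| := by gcongr; exact (hk.2.trans_eq hlk1).le
      dsimp only
      linarith
  obtain ⟨e, he⟩ := exists_surjective_nat (ℤ × ℕ × ℤ)
  have hsub : ∀ i, disjointed (F ∘ e) i ⊆ F (e i) := fun i => disjointed_subset _ i
  refine ⟨disjointed (F ∘ e), fun i => l ^ (e i).1, fun i => .disjointed (fun i => hFm (e i)) i,
    disjoint_disjointed _, ?_, fun i => zpow_pos hl0 _, fun i t ht => ?_, fun i s hs t ht => ?_⟩
  · rw [iUnion_disjointed, ← hFP]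
    exact he.iUnion_comp F
  · have h := (hsub i ht).1.1.2
    refine ⟨h.1, h.2.le.trans_eq ?_⟩
    rw [zpow_add_one₀ hl0.ne', mul_comm]
  · have hs' := hsub i hs
    have ht' := hsub i ht
    have hst := abs_sub_lt_of_floor_div_eq Nat.one_div_pos_of_nat (hs'.2.trans ht'.2.symm)
    exact ⟨ht'.1.2.1.2 s hs'.1.2.1.1 hst, ht'.1.2.2.2 s hs'.1.2.1.1 hst⟩

variable [MeasurableSpace Y] [BorelSpace Y]

theorem lipschitzOnWith_hausdorffMeasure_image_le {E : Set ℝ} {c : ℝ≥0}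
    (h : LipschitzOnWith c η E) : μH[1] (η '' E) ≤ c * volume E := by
  have := h.hausdorffMeasure_image_le zero_le_one
  rwa [ENNReal.rpow_one, hausdorffMeasure_real] at this

theorem le_hausdorffMeasure_image_of_le_dist {E : Set ℝ} {c : ℝ} (hc : 0 < c)
    (h : ∀ s ∈ E, ∀ t ∈ E, c * |s - t| ≤ dist (η s) (η t)) :
    ENNReal.ofReal c * volume E ≤ μH[1] (η '' E) := by
  have hinj : InjOn η E := fun s hs t ht hst => by
    have h1 := h s hs t ht
    rw [hst, dist_self] at h1
    exact sub_eq_zero.1 (abs_eq_zero.1 (le_antisymm (by nlinarith) (abs_nonneg _)))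
  have hleft := hinj.leftInvOn_invFunOn
  have hlip : LipschitzOnWith (Real.toNNReal c⁻¹) (Function.invFunOn η E) (η '' E) := by
    refine LipschitzOnWith.of_dist_le_mul ?_
    rintro _ ⟨s, hs, rfl⟩ _ ⟨t, ht, rfl⟩
    rw [hleft hs, hleft ht, Real.coe_toNNReal _ (inv_pos.2 hc).le, Real.dist_eq, inv_mul_eq_div,
      le_div_iff₀ hc, mul_comm]
    exact h s hs t ht
  have h1 := hlip.hausdorffMeasure_image_le zero_le_one
  rw [ENNReal.rpow_one, hausdorffMeasure_real, hleft.image_image] at h1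
  calc ENNReal.ofReal c * volume E
      ≤ ENNReal.ofReal c * (ENNReal.ofReal c⁻¹ * μH[1] (η '' E)) := by gcongr; exact h1
    _ = μH[1] (η '' E) := by
      rw [← mul_assoc, ← ENNReal.ofReal_mul hc.le, mul_inv_cancel₀ hc.ne', ENNReal.ofReal_one,
        one_mul]

/-- A map that is Lipschitz at a fixed scale increases length at most by the Lipschitz constant. -/
theorem hausdorffMeasure_image_le_of_dist_le_of_abs_lt {B J : Set ℝ} (hBJ : B ⊆ J)
    (hJ : MeasurableSet J) {c : ℝ≥0} {δ : ℝ} (hδ : 0 < δ)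
    (h : ∀ s ∈ B, ∀ t ∈ B, |s - t| < δ → dist (η s) (η t) ≤ c * |s - t|) :
    μH[1] (η '' B) ≤ c * volume J := by
  set I : ℤ → Set ℝ := fun j => {t | ⌊t / δ⌋ = j} with hI
  have hcover : ∀ A : Set ℝ, A = ⋃ j, A ∩ I j := fun A => by
    rw [← inter_iUnion, eq_comm, inter_eq_left]
    exact fun t _ => mem_iUnion.2 ⟨⌊t / δ⌋, rfl⟩
  have hdisj : Pairwise (Function.onFun Disjoint fun j => J ∩ I j) := fun i j hij =>
    disjoint_left.2 fun t ht1 ht2 => hij (ht1.2.symm.trans ht2.2)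
  calc μH[1] (η '' B) = μH[1] (⋃ j, η '' (B ∩ I j)) := by rw [← image_iUnion, ← hcover]
    _ ≤ ∑' j, μH[1] (η '' (B ∩ I j)) := measure_iUnion_le _
    _ ≤ ∑' j, c * volume (J ∩ I j) := by
      refine ENNReal.tsum_le_tsum fun j => ?_
      have hlip : LipschitzOnWith c η (B ∩ I j) := LipschitzOnWith.of_dist_le_mul
        fun s hs t ht => h s hs.1 t ht.1 (abs_sub_lt_of_floor_div_eq hδ (hs.2.trans ht.2.symm))
      refine (lipschitzOnWith_hausdorffMeasure_image_le hlip).trans ?_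
      gcongr
    _ = c * volume J := by
      rw [ENNReal.tsum_mul_left,
        ← measure_iUnion hdisj fun j => hJ.inter (measurableSet_floor_div_eq δ j), ← hcover]

/-- The image of the set where the speed vanishes is a null set. -/
theorem hausdorffMeasure_image_eq_zero_of_hasSpeedAt_zero {B : Set ℝ} (hBC : B ⊆ C)
    (hB : ∀ t ∈ B, HasSpeedAt η C t 0) : μH[1] (η '' B) = 0 := by
  have hbdd : ∀ k : ℤ, μH[1] (η '' (B ∩ Ico (k : ℝ) (k + 1))) = 0 := by
    intro k
    refine le_antisymm (ENNReal.le_of_forall_pos_le_add fun ε hε _ => ?_) zero_le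
    set D : ℕ → Set ℝ := fun n => {t | t ∈ B ∩ Ico (k : ℝ) (k + 1) ∧
      ∀ s ∈ C, |s - t| < 1 / ((n : ℝ) + 1) → dist (η s) (η t) ≤ ε * |s - t|}
    have hmono : Monotone D := fun n n' hn t ht =>
      ⟨ht.1, fun s hs hst => ht.2 s hs (hst.trans_le (by gcongr))⟩
    have hunion : B ∩ Ico (k : ℝ) (k + 1) = ⋃ n, D n := by
      refine Subset.antisymm (fun t ht => ?_) (iUnion_subset fun n t ht => ht.1)
      obtain ⟨δ, hδ, h⟩ := hB t ht.1 ε hε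
      obtain ⟨n, hn⟩ := exists_nat_one_div_lt hδ
      refine mem_iUnion.2 ⟨n, ht, fun s hs hst => ?_⟩
      have := h s hs (hst.trans hn)
      rwa [zero_mul, sub_zero, abs_of_nonneg dist_nonneg] at this
    have hmono' : Monotone fun n => η '' D n := fun n n' hn => image_mono (hmono hn)
    rw [hunion, image_iUnion, hmono'.measure_iUnion, zero_add]
    refine iSup_le fun n => ?_
    refine (hausdorffMeasure_image_le_of_dist_le_of_abs_lt (fun t ht => ht.1.2) measurableSet_Ico
      (Nat.one_div_pos_of_nat (n := n)) fun s hs t ht hst => ht.2 s (hBC hs.1.1) hst).trans ?_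
    simp
  have hcover : B = ⋃ k : ℤ, B ∩ Ico (k : ℝ) (k + 1) := by
    rw [← inter_iUnion, iUnion_Ico_intCast, inter_univ]
  rw [hcover, image_iUnion]
  exact measure_iUnion_null hbdd

theorem le_of_forall_le_ofReal_sq_mul {a b : ℝ≥0∞}
    (h : ∀ l : ℝ, 1 < l → a ≤ ENNReal.ofReal (l ^ 2) * b) : a ≤ b := by
  have h1 : Tendsto (fun l : ℝ => ENNReal.ofReal (l ^ 2)) (𝓝[>] 1) (𝓝 1) := by
    have : Continuous fun l : ℝ => ENNReal.ofReal (l ^ 2) :=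
      ENNReal.continuous_ofReal.comp (continuous_pow 2)
    simpa using (this.tendsto 1).mono_left nhdsWithin_le_nhds
  have h2 := ENNReal.Tendsto.mul_const (b := b) h1 (Or.inl one_ne_zero)
  rw [one_mul] at h2
  exact ge_of_tendsto h2 (by filter_upwards [self_mem_nhdsWithin] with l hl using h l hl)

theorem lintegral_encard_eq_of_pos (hC : IsClosed C) (hη : ContinuousOn η C) {m : ℝ → ℝ}
    (hm : Measurable m) {P : Set ℝ} (hP : MeasurableSet P) (hPC : P ⊆ C) (hpos : ∀ t ∈ P, 0 < m t)
    (hspeed : ∀ t ∈ P, HasSpeedAt η C t (m t)) :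
    ∫⁻ z, (({t | t ∈ P ∧ η t = z}.encard : ℕ∞) : ℝ≥0∞) ∂(μH[1] : Measure Y) =
      ∫⁻ t in P, ENNReal.ofReal (m t) := by
  have key : ∀ l : ℝ, 1 < l → ∃ x y : ℕ → ℝ≥0∞,
      ∫⁻ z, (({t | t ∈ P ∧ η t = z}.encard : ℕ∞) : ℝ≥0∞) ∂(μH[1] : Measure Y) = ∑' i, x i ∧
      ∫⁻ t in P, ENNReal.ofReal (m t) = ∑' i, y i ∧
      (∀ i, x i ≤ ENNReal.ofReal (l ^ 2) * y i) ∧ ∀ i, y i ≤ ENNReal.ofReal (l ^ 2) * x i := by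
    intro l hl
    have hl0 : 0 < l := one_pos.trans hl
    obtain ⟨E, c, hEm, hEd, hEP, hc, hcm, hdist⟩ :=
      exists_bilipschitz_decomposition hC hη hm hP hPC hpos hspeed hl
    have hinj : ∀ i, InjOn η (E i) := fun i s hs t ht hst => by
      have h1 := (hdist i s hs t ht).1
      rw [hst, dist_self] at h1
      have h2 : 0 < l⁻¹ * c i := mul_pos (inv_pos.2 hl0) (hc i)
      exact sub_eq_zero.1 (abs_eq_zero.1 (le_antisymm (by nlinarith) (abs_nonneg _)))
    have hEC : ∀ i, E i ⊆ C := fun i => ((subset_iUnion E i).trans_eq hEP).trans hPC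
    have himage : ∀ i, MeasurableSet (η '' E i) := fun i =>
      (hEm i).image_of_continuousOn_injOn (hη.mono (hEC i)) (hinj i)
    refine ⟨fun i => μH[1] (η '' E i), fun i => ∫⁻ t in E i, ENNReal.ofReal (m t), ?_, ?_,
      fun i => ?_, fun i => ?_⟩
    · rw [← hEP]
      simp_rw [encard_eq_tsum_indicator hEd hinj]
      rw [lintegral_tsum fun i => (measurable_const.indicator (himage i)).aemeasurable]
      exact tsum_congr fun i => lintegral_indicator_one (himage i)
    · rw [← hEP, lintegral_iUnion hEm hEd]
    · have hlip : LipschitzOnWith (Real.toNNReal (l ^ 2 * c i)) η (E i) :=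
        LipschitzOnWith.of_dist_le_mul fun s hs t ht => by
          rw [Real.coe_toNNReal _ (by have := hc i; positivity)]
          exact (hdist i s hs t ht).2
      calc μH[1] (η '' E i) ≤ ENNReal.ofReal (l ^ 2 * c i) * volume (E i) :=
            lipschitzOnWith_hausdorffMeasure_image_le hlip
        _ = ENNReal.ofReal (l ^ 2) * ∫⁻ _ in E i, ENNReal.ofReal (c i) := by
          rw [setLIntegral_const, ENNReal.ofReal_mul (by positivity), mul_assoc]
        _ ≤ ENNReal.ofReal (l ^ 2) * ∫⁻ t in E i, ENNReal.ofReal (m t) := by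
          refine mul_le_mul_right ?_ _
          exact setLIntegral_mono' (hEm i) fun t ht => ENNReal.ofReal_le_ofReal (hcm i t ht).1
    · calc ∫⁻ t in E i, ENNReal.ofReal (m t) ≤ ∫⁻ _ in E i, ENNReal.ofReal (l * c i) :=
            setLIntegral_mono' (hEm i) fun t ht => ENNReal.ofReal_le_ofReal (hcm i t ht).2
        _ = ENNReal.ofReal (l ^ 2) * (ENNReal.ofReal (l⁻¹ * c i) * volume (E i)) := by
          rw [setLIntegral_const, ← mul_assoc, ← ENNReal.ofReal_mul (by positivity)]
          congr 2
          field_simp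
        _ ≤ ENNReal.ofReal (l ^ 2) * μH[1] (η '' E i) := by
          refine mul_le_mul_right ?_ _
          exact le_hausdorffMeasure_image_of_le_dist (mul_pos (inv_pos.2 hl0) (hc i))
            fun s hs t ht => (hdist i s hs t ht).1
  refine le_antisymm (le_of_forall_le_ofReal_sq_mul fun l hl => ?_)
    (le_of_forall_le_ofReal_sq_mul fun l hl => ?_)
  · obtain ⟨x, y, hx, hy, h1, -⟩ := key l hl
    rw [hx, hy, ← ENNReal.tsum_mul_left]
    exact ENNReal.tsum_le_tsum h1
  · obtain ⟨x, y, hx, hy, -, h2⟩ := key l hl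
    rw [hx, hy, ← ENNReal.tsum_mul_left]
    exact ENNReal.tsum_le_tsum h2

/-- The area formula for Lipschitz curve fragments: the length, counted with multiplicity, is the
integral of the speed. -/
theorem lintegral_encard_eq (hC : IsClosed C) (hη : LipschitzOnWith L η C) {m : ℝ → ℝ}
    (hm : AEMeasurable m (volume.restrict C)) (hm0 : ∀ t, 0 ≤ m t)
    (hspeed : ∀ᵐ t, t ∈ C → HasSpeedAt η C t (m t)) :
    ∫⁻ z, (({t | t ∈ C ∧ η t = z}.encard : ℕ∞) : ℝ≥0∞) ∂(μH[1] : Measure Y) =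
      ∫⁻ t in C, ENNReal.ofReal (m t) := by
  set Q : ℝ → Prop := fun t => m t = hm.mk m t ∧ HasSpeedAt η C t (m t)
  have hQ : ∀ᵐ t, t ∈ C → Q t := by
    filter_upwards [hspeed, (ae_restrict_iff' hC.measurableSet).1 hm.ae_eq_mk] with t h1 h2 ht
    exact ⟨h2 ht, h1 ht⟩
  set N := toMeasurable volume {t | ¬ (t ∈ C → Q t)}
  have hN : volume N = 0 := by rw [measure_toMeasurable]; exact ae_iff.1 hQ
  have hNQ : ∀ t ∈ C \ N, Q t := fun t ht => by
    by_contra h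
    exact ht.2 (subset_toMeasurable _ _ fun h' => h (h' ht.1))
  set P := (C \ N) ∩ {t | 0 < hm.mk m t}
  have hTm : MeasurableSet (C \ N) := hC.measurableSet.diff (measurableSet_toMeasurable _ _)
  have hP : MeasurableSet P := hTm.inter (measurableSet_lt measurable_const hm.measurable_mk)
  have hPC : P ⊆ C := fun t ht => ht.1.1
  set Z := (C \ N) ∩ {t | hm.mk m t ≤ 0}
  have hZ : ∀ t ∈ Z, m t = 0 := fun t ht =>
    le_antisymm ((hNQ t ht.1).1.trans_le ht.2) (hm0 t)
  have hCP : C \ P ⊆ (C ∩ N) ∪ Z := fun t ht => by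
    by_cases htN : t ∈ N
    · exact Or.inl ⟨ht.1, htN⟩
    · exact Or.inr ⟨⟨ht.1, htN⟩, not_lt.1 fun h : 0 < hm.mk m t => ht.2 ⟨⟨ht.1, htN⟩, h⟩⟩
  have hnull : μH[1] (η '' (C \ P)) = 0 := by
    refine measure_mono_null ((image_mono hCP).trans_eq (image_union _ _ _)) ?_
    refine measure_union_null ?_ ?_
    · refine le_antisymm ((lipschitzOnWith_hausdorffMeasure_image_le
        (hη.mono inter_subset_left)).trans_eq ?_) zero_le
      rw [measure_mono_null inter_subset_right hN, mul_zero]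
    · refine hausdorffMeasure_image_eq_zero_of_hasSpeedAt_zero (C := C) (fun t ht => ht.1.1)
        fun t ht => ?_
      rw [← hZ t ht]
      exact (hNQ t ht.1).2
  have hleft : ∫⁻ z, (({t | t ∈ C ∧ η t = z}.encard : ℕ∞) : ℝ≥0∞) ∂(μH[1] : Measure Y) =
      ∫⁻ z, (({t | t ∈ P ∧ η t = z}.encard : ℕ∞) : ℝ≥0∞) ∂(μH[1] : Measure Y) := by
    refine lintegral_congr_ae ?_
    filter_upwards [measure_eq_zero_iff_ae_notMem.1 hnull] with z hz
    congr 2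
    ext t
    refine and_congr_left fun htz => ⟨fun ht => ?_, fun ht => hPC ht⟩
    by_contra htP
    exact hz ⟨t, ⟨ht, htP⟩, htz⟩
  have hright : ∫⁻ t in C, ENNReal.ofReal (m t) = ∫⁻ t in P, ENNReal.ofReal (hm.mk m t) := by
    have hzero : ∫⁻ t in C \ P, ENNReal.ofReal (m t) = 0 := by
      refine (setLIntegral_congr_fun_ae (g := fun _ => 0) (hC.measurableSet.diff hP) ?_).trans
        (by simp)
      filter_upwards [measure_eq_zero_iff_ae_notMem.1 hN] with t ht htCP
      rcases hCP htCP with h | h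
      · exact absurd h.2 ht
      · rw [hZ t h, ENNReal.ofReal_zero]
    rw [← lintegral_inter_add_sdiff _ C hP, inter_eq_right.2 hPC, hzero, add_zero]
    exact setLIntegral_congr_fun hP fun t ht => by rw [(hNQ t ht.1).1]
  rw [hleft, hright]
  refine lintegral_encard_eq_of_pos hC hη.continuousOn hm.measurable_mk hP hPC (fun t ht => ht.2)
    fun t ht => ?_
  rw [← (hNQ t ht.1).1]
  exact (hNQ t ht.1).2

theorem lintegral_encard_eq_hausdorffMeasure (hC : MeasurableSet C) (hη : ContinuousOn η C)
    (hinj : InjOn η C) :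
    ∫⁻ z, (({t | t ∈ C ∧ η t = z}.encard : ℕ∞) : ℝ≥0∞) ∂(μH[1] : Measure Y) =
      μH[1] (η '' C) := by
  rw [← lintegral_indicator_one (hC.image_of_continuousOn_injOn hη hinj)]
  refine lintegral_congr fun z => ?_
  by_cases hz : z ∈ η '' C
  · obtain ⟨t, ht, rfl⟩ := hz
    rw [indicator_of_mem (mem_image_of_mem η ht)]
    have : {s | s ∈ C ∧ η s = η t} = {t} :=
      Subset.antisymm (fun s hs => hinj hs.1 ht hs.2) fun s hs => by
        rw [mem_singleton_iff.1 hs]; exact ⟨ht, rfl⟩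
    simp [this]
  · rw [indicator_of_notMem hz]
    have : {s | s ∈ C ∧ η s = z} = ∅ :=
      eq_empty_of_forall_notMem fun s hs => hz ⟨s, hs.1, hs.2⟩
    simp [this]

end Area

/-! ### Velocity vectors and the main theorem -/

section Fragment

variable {X : Type*} [MetricSpace X] {γ : ℝ → X} {C : Set ℝ} {t : ℝ}

theorem HasChartDerivAt.hasDerivWithinAt {n : ℕ} {F : Type*} [NormedAddCommGroup F]
    [NormedSpace ℝ F] {φ : X → EuclideanSpace ℝ (Fin n)} {f : X → F}
    {L : EuclideanSpace ℝ (Fin n) →L[ℝ] F} {v : EuclideanSpace ℝ (Fin n)} {K : ℝ≥0}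
    (h : HasChartDerivAt φ f (γ t) L) (hγ : LipschitzOnWith K γ C) (ht : t ∈ C)
    (hv : HasDerivWithinAt (φ ∘ γ) v C t) : HasDerivWithinAt (f ∘ γ) (L v) C t := by
  rw [hasDerivWithinAt_iff_isLittleO] at hv ⊢
  have h1 : (fun s => dist (γ s) (γ t)) =O[𝓝[C] t] fun s => s - t := by
    refine IsBigO.of_bound K ?_
    filter_upwards [self_mem_nhdsWithin] with s hs
    rw [Real.norm_of_nonneg dist_nonneg, ← dist_eq_norm]
    exact hγ.dist_le_mul s hs t ht
  have h2 := (h.comp_tendsto (hγ.continuousOn t ht)).trans_isBigO h1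
  refine (h2.add ((L.isBigO_comp _ _).trans_isLittleO hv)).congr_left fun s => ?_
  simp only [Function.comp_apply, map_sub, map_smul]
  abel

theorem IsGenericPair.hasDerivWithinAt_chart [MeasurableSpace X] {G : GenericityData X} {n : ℕ}
    {φ : X → EuclideanSpace ℝ (Fin n)} (h : IsGenericPair G γ C t)
    (hφ : ∀ i, components φ i ∈ G.lip) :
    HasDerivWithinAt (φ ∘ γ) (derivWithin (φ ∘ γ) C t) C t :=
  (differentiableWithinAt_euclidean.2 fun i => (h.lip _ (hφ i)).1.2).hasDerivWithinAt

namespace Atlas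

variable [MeasurableSpace X] {μ : Measure X} (A : Atlas μ)

theorem derivWithin_mem_tangentSpace {K : ℝ≥0} (hγ : LipschitzOnWith K γ C) (ht : t ∈ C)
    (hacc : AccPt t (𝓟 C))
    (hd : ∀ α, HasDerivWithinAt (A.φ α ∘ γ) (derivWithin (A.φ α ∘ γ) C t) C t) :
    (fun α : {α : A.ι // γ t ∈ A.U α} => derivWithin (A.φ α ∘ γ) C t) ∈ A.tangentSpace (γ t) :=
  fun α β => ((A.compatible α β (γ t) ⟨α.2, β.2⟩).hasChartDerivAt.hasDerivWithinAt hγ ht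
    (hd α)).derivWithin (uniqueDiffWithinAt_iff_accPt.2 hacc) |>.symm

theorem velocity_apply (h : (fun α : {α : A.ι // γ t ∈ A.U α} => derivWithin (A.φ α ∘ γ) C t) ∈
      A.tangentSpace (γ t)) (α : {α : A.ι // γ t ∈ A.U α}) :
    (A.velocity γ C t).1 α = derivWithin (A.φ α ∘ γ) C t := by
  rw [velocity, dif_pos h]

/-- Derivatives along `γ` are given by the differential, applied to the velocity vector. -/
theorem derivWithin_comp_eq_differential {K : ℝ≥0} (hγ : LipschitzOnWith K γ C) (ht : t ∈ C)
    (hacc : AccPt t (𝓟 C)) (hU : γ t ∈ ⋃ α, A.U α)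
    (hv : ∀ α : {α : A.ι // γ t ∈ A.U α},
      HasDerivWithinAt (A.φ α ∘ γ) ((A.velocity γ C t).1 α) C t)
    {f : X → ℝ} (hf : ∀ α, γ t ∈ A.U α → ChartDifferentiableAt (A.φ α) f (γ t)) :
    derivWithin (f ∘ γ) C t = A.differential f (γ t) (A.velocity γ C t) := by
  obtain ⟨α, hα⟩ := mem_iUnion.1 hU
  rw [A.differential_apply hf _ ⟨α, hα⟩]
  exact ((hf α hα).hasChartDerivAt.hasDerivWithinAt hγ ht (hv ⟨α, hα⟩)).derivWithin
    (uniqueDiffWithinAt_iff_accPt.2 hacc)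

end Atlas

theorem IsLipschitzCompatible.exists_lipschitzWith_toQuotient {ρ : PseudoMetric X ℝ}
    (hρ : IsLipschitzCompatible ρ) : ∃ K, LipschitzWith K (toQuotient ρ) := by
  obtain ⟨c, hc, h⟩ := hρ
  refine ⟨c.toNNReal, LipschitzWith.of_dist_le_mul fun x y => ?_⟩
  rw [dist_toQuotient, Real.coe_toNNReal _ hc]
  exact h x y

theorem denseRange_toQuotient {ρ : PseudoMetric X ℝ} (hρ : IsLipschitzCompatible ρ) {D : Set X}
    (hD : Dense D) : DenseRange fun x : D => toQuotient ρ x := by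
  obtain ⟨K, hK⟩ := hρ.exists_lipschitzWith_toQuotient
  have hsurj : Function.Surjective (toQuotient ρ) :=
    SeparationQuotient.surjective_mk (X := WithPseudometric ρ)
  exact hsurj.denseRange.comp hD.denseRange_val hK.continuous

theorem hasSpeedAt_of_eventually {Y : Type*} [MetricSpace Y] {η : ℝ → Y} {m : ℝ} (ht : t ∈ C)
    (h : ∀ ε > 0, ∀ᶠ r : ℝ in 𝓝[>] 0, ∀ a ∈ C ∩ Icc (t - r) (t + r),
      ∀ b ∈ C ∩ Icc (t - r) (t + r), abs (dist (η a) (η b) - m * |a - b|) ≤ ε * r) :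
    HasSpeedAt η C t m := by
  intro ε hε
  obtain ⟨δ, hδ, hδε⟩ := mem_nhdsGT_iff_exists_Ioo_subset.1 (h ε hε)
  refine ⟨δ, hδ, fun s hs hst => ?_⟩
  rcases eq_or_ne s t with rfl | hne
  · simp
  · have hpos := abs_pos.2 (sub_ne_zero.2 hne)
    have h1 := abs_le.1 (le_refl |s - t|)
    exact hδε ⟨hpos, hst⟩ s ⟨hs, by linarith [h1.1], by linarith [h1.2]⟩ t
      ⟨ht, by linarith, by linarith⟩

theorem approxContinuousAt_supSpeed_iff {X : Type*} {γ : ℝ → X} {ρ : PseudoMetric X ℝ} {D : Set X} :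
    ApproxContinuousAt (supSpeed (fun x : D => toQuotient ρ x) (toQuotient ρ ∘ γ) C)
      {s | s ∈ C ∧ ∀ x : D, DifferentiableWithinAt ℝ
        (fun s => dist (toQuotient ρ x) ((toQuotient ρ ∘ γ) s)) C s} t ↔
    ApproxContinuousAt (fun s => ⨆ x : D, |derivWithin (fun s => ρ x (γ s)) C s|)
      {s | s ∈ C ∧ ∀ x ∈ D, DifferentiableWithinAt ℝ (fun s => ρ x (γ s)) C s} t := by
  have hset : {s | s ∈ C ∧ ∀ x : D, DifferentiableWithinAt ℝ
        (fun s => dist (toQuotient ρ x) ((toQuotient ρ ∘ γ) s)) C s} =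
      {s | s ∈ C ∧ ∀ x ∈ D, DifferentiableWithinAt ℝ (fun s => ρ x (γ s)) C s} :=
    ext fun s => and_congr_right fun _ => Subtype.forall
  rw [hset]
  rfl

variable [MeasurableSpace X]

theorem IsGenericPair.approxContinuousAt_supSpeed {G : GenericityData X}
    (h : IsGenericPair G γ C t) {ρ : PseudoMetric X ℝ} (hρ : ρ ∈ G.sem) :
    ApproxContinuousAt (supSpeed (fun x : G.D => toQuotient ρ x) (toQuotient ρ ∘ γ) C)
      {s | s ∈ C ∧ ∀ x : G.D, DifferentiableWithinAt ℝ
        (fun s => dist (toQuotient ρ x) ((toQuotient ρ ∘ γ) s)) C s} t :=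
  approxContinuousAt_supSpeed_iff.2 (h.sup_distance ρ hρ)

theorem IsGenericPair.hasDerivWithinAt_velocity {G : GenericityData X} {μ : Measure X}
    {A : Atlas μ} (h : IsGenericPair G γ C t) {K : ℝ≥0} (hγ : LipschitzOnWith K γ C)
    (hφ : ∀ (α : A.ι) (i : Fin (A.N α)), components (A.φ α) i ∈ G.lip)
    (α : {α : A.ι // γ t ∈ A.U α}) :
    HasDerivWithinAt (A.φ α ∘ γ) ((A.velocity γ C t).1 α) C t := by
  have hd := fun α => h.hasDerivWithinAt_chart (hφ α)
  rw [A.velocity_apply (A.derivWithin_mem_tangentSpace hγ h.mem h.density.accPt hd)]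
  exact hd α

theorem IsGenericPair.tangentSeminorm_velocity {G : GenericityData X} {μ : Measure X}
    {A : Atlas μ} {ρ : PseudoMetric X ℝ} {V : Set X}
    (hV : A.IsDifferentiabilitySet (distanceFunctions ρ G.D) V) (h : IsGenericPair G γ C t)
    {K : ℝ≥0} (hγ : LipschitzOnWith K γ C)
    (hφ : ∀ (α : A.ι) (i : Fin (A.N α)), components (A.φ α) i ∈ G.lip) (htV : γ t ∈ V) :
    A.tangentSeminorm ρ G.D (γ t) (A.velocity γ C t) =
      supSpeed (fun x : G.D => toQuotient ρ x) (toQuotient ρ ∘ γ) C t :=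
  iSup_congr fun x => congrArg abs (A.derivWithin_comp_eq_differential hγ h.mem h.density.accPt
    (hV.subset htV) (h.hasDerivWithinAt_velocity hγ hφ)
    (hV.differentiable _ htV _ ⟨x, x.2, rfl⟩)).symm

theorem ae_isGenericPair [BorelSpace X] (G : GenericityData X) (hC : IsClosed C) {K : ℝ≥0}
    (hγ : LipschitzOnWith K γ C) : ∀ᵐ t, t ∈ C → IsGenericPair G γ C t := by
  have hCm := hC.measurableSet
  have hDc : Countable G.D := G.D_countable.to_subtype
  have hlip := (ae_ball_iff G.lip_countable).2 fun f hf => by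
    obtain ⟨K', hK'⟩ := G.lip_lipschitz f hf
    have hfγ := hK'.comp_lipschitzOnWith hγ
    exact ae_approxContinuousAt_of_ae hCm (ae_differentiableWithinAt_of_lipschitzOnWith hfγ)
      (aemeasurable_derivWithin_of_lipschitzOnWith hCm hfγ)
  have hbor := (ae_ball_iff G.bor_countable).2 fun u hu =>
    ae_approxContinuousAt hCm.nullMeasurableSet
      ((G.bor_measurable u hu).comp_aemeasurable (hγ.continuousOn.aemeasurable hCm))
  have hdist := (ae_ball_iff G.D_countable).2 fun x _ =>
    (ae_ball_iff G.sem_countable).2 fun ρ hρ => by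
      obtain ⟨K', hK'⟩ := (G.sem_compatible ρ hρ).exists_lipschitzWith_toQuotient
      have hfγ : LipschitzOnWith (K' * K) (fun s => ρ x (γ s)) C :=
        lipschitzOnWith_dist_comp (hK'.comp_lipschitzOnWith hγ) (toQuotient ρ x)
      exact ae_approxContinuousAt_of_ae hCm (ae_differentiableWithinAt_of_lipschitzOnWith hfγ)
        (aemeasurable_derivWithin_of_lipschitzOnWith hCm hfγ)
  have hsup := (ae_ball_iff G.sem_countable).2 fun ρ hρ => by
    obtain ⟨K', hK'⟩ := (G.sem_compatible ρ hρ).exists_lipschitzWith_toQuotient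
    exact ae_approxContinuousAt_supSpeed (fun x : G.D => toQuotient ρ x) hCm
      (hK'.comp_lipschitzOnWith hγ)
  filter_upwards [ae_isDensityPoint hCm.nullMeasurableSet, hlip, hbor, hdist, hsup]
    with t h1 h2 h3 h4 h5 ht
  exact ⟨ht, h1 ht, fun f hf => h2 f hf ht, fun u hu => h3 u hu ht,
    fun x hx ρ hρ => h4 x hx ρ hρ ht, fun ρ hρ =>
    approxContinuousAt_supSpeed_iff.1 (h5 ρ hρ ht)⟩

end Fragment

end MetricDiff

theorem theorem1p2 {X : Type*} [MetricSpace X] [CompleteSpace X]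
    [TopologicalSpace.SeparableSpace X] [MeasurableSpace X] [BorelSpace X]
    (μ : Measure X) [IsLocallyFiniteMeasure μ] (A : MetricDiff.Atlas μ)
    (G : MetricDiff.GenericityData X) (ρ : PseudoMetric X ℝ) (hρ : ρ ∈ G.sem)
    (V : Set X) (hV : A.IsDifferentiabilitySet (MetricDiff.distanceFunctions ρ G.D) V)
    (hφ : ∀ (α : A.ι) (i : Fin (A.N α)), MetricDiff.components (A.φ α) i ∈ G.lip)
    (hU : ∀ α : A.ι, (A.U α).indicator (fun _ => (1 : ℝ)) ∈ G.bor)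
    (hVG : V.indicator (fun _ => (1 : ℝ)) ∈ G.bor)
    (C : Set ℝ) (hC : IsClosed C) (γ : ℝ → X) (hγ : ∃ K, LipschitzOnWith K γ C) :
    (∀ t, MetricDiff.IsGenericPair G γ C t → γ t ∈ V →
      (∀ α : {α : A.ι // γ t ∈ A.U α},
        HasDerivWithinAt (A.φ α ∘ γ) ((A.velocity γ C t).1 α) C t) ∧
      MetricDiff.HasMetricDerivAt ρ γ C t
        (A.tangentSeminorm ρ G.D (γ t) (A.velocity γ C t))) ∧
    ((∀ t ∈ C, γ t ∈ V) → MetricDiff.IsGenericFragment G V γ C) ∧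
    (MetricDiff.IsGenericFragment G V γ C →
      MetricDiff.length ρ γ C =
        ∫⁻ t in C, ENNReal.ofReal (A.tangentSeminorm ρ G.D (γ t) (A.velocity γ C t)) ∧
      ((∀ s ∈ C, ∀ t ∈ C, ρ (γ s) (γ t) = 0 → s = t) →
        MetricDiff.hausdorff ρ (γ '' C) =
          ∫⁻ t in C, ENNReal.ofReal (A.tangentSeminorm ρ G.D (γ t) (A.velocity γ C t)))) := by
  obtain ⟨K, hγ⟩ := hγ
  have : Countable G.D := G.D_countable.to_subtype
  have : Nonempty G.D := (G.D_dense.nonempty_iff.2 ⟨γ 0⟩).to_subtype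
  obtain ⟨K', hK'⟩ := (G.sem_compatible ρ hρ).exists_lipschitzWith_toQuotient
  have hη := hK'.comp_lipschitzOnWith hγ
  have hp := MetricDiff.denseRange_toQuotient (G.sem_compatible ρ hρ) G.D_dense
  have hdist : ∀ t, MetricDiff.IsGenericPair G γ C t → ∀ ε > 0, ∀ᶠ r : ℝ in 𝓝[>] 0,
      ∀ a ∈ C ∩ Icc (t - r) (t + r), ∀ b ∈ C ∩ Icc (t - r) (t + r),
      abs (dist ((MetricDiff.toQuotient ρ ∘ γ) a) ((MetricDiff.toQuotient ρ ∘ γ) b) -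
        MetricDiff.supSpeed (fun x : G.D => MetricDiff.toQuotient ρ x)
          (MetricDiff.toQuotient ρ ∘ γ) C t * |a - b|) ≤ ε * r := fun t ht ε hε =>
    MetricDiff.eventually_abs_dist_sub_le hp hC.measurableSet hη
      (ht.approxContinuousAt_supSpeed hρ) hε
  refine ⟨fun t ht htV => ⟨ht.hasDerivWithinAt_velocity hγ hφ, ?_⟩, fun h => ?_, fun hgen => ?_⟩
  · rw [ht.tangentSeminorm_velocity hV hγ hφ htV]
    exact MetricDiff.hasMetricDerivAt_of_eventually (MetricDiff.supSpeed_nonneg _ t) (hdist t ht)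
  · exact (MetricDiff.ae_isGenericPair G hC hγ).mono fun t ht htC => ⟨ht htC, h t htC⟩
  · have hlength : MetricDiff.length ρ γ C =
        ∫⁻ t in C, ENNReal.ofReal (A.tangentSeminorm ρ G.D (γ t) (A.velocity γ C t)) := by
      refine (MetricDiff.lintegral_encard_eq hC hη
        (MetricDiff.aemeasurable_supSpeed (fun x : G.D => MetricDiff.toQuotient ρ x)
          hC.measurableSet hη) (MetricDiff.supSpeed_nonneg _) ?_).trans
        (setLIntegral_congr_fun_ae hC.measurableSet ?_)
      · exact hgen.mono fun t ht htC =>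
          MetricDiff.hasSpeedAt_of_eventually htC (hdist t (ht htC).1)
      · filter_upwards [hgen] with t ht htC
        rw [(ht htC).1.tangentSeminorm_velocity hV hγ hφ (ht htC).2]
    refine ⟨hlength, fun hinj => ?_⟩
    rw [← hlength, MetricDiff.hausdorff, ← image_comp]
    refine (MetricDiff.lintegral_encard_eq_hausdorffMeasure hC.measurableSet hη.continuousOn
      fun s hs t ht hst => hinj s hs t ht ?_).symm
    rw [← MetricDiff.dist_toQuotient]
    exact dist_eq_zero.2 hst
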